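/- Let $p$ be a prime and let $X$ be a finite connected multigraph (loops and multiple edges allowed) in which a direction has been chosen for every edge; let $S$ be the set of these directed edges. For a map $\alpha\colon S\to\mathbb{Z}_p$ (a voltage assignment) and $m\ge 0$, let $\alpha_m\colon S\to\mathbb{Z}/p^m\mathbb{Z}$ be its reduction and let $X_m$ be the derived multigraph with vertex set $V(X)\times\mathbb{Z}/p^m\mathbb{Z}$ which has, for every $e\in S$ from $v$ to $w$ and every $g\in\mathbb{Z}/p^m\mathbb{Z}$, one edge from $(v,g)$ to $(w,g+\alpha_m(e))$. Let $\mathcal{E}^1(X)$ be the set of voltage $\mathbb{Z}_p$-covers $X_\infty$ of $X$, i.e. of those voltage assignments $\alpha$ for which all the graphs $X_m$ are connected. For $X_\infty\in\mathcal{E}^1(X)$ given by $\alpha$ and $m\ge 0$, let $\mathcal{E}^1(X_\infty,m)$ be the set of all $\tilde X_\infty\in\mathcal{E}^1(X)$ whose voltage assignment $\tilde\alpha$ satisfies $\tilde\alpha_m=\alpha_m$. For a finite multigraph $Y$ let $J(Y)=\mathrm{Div}^0(Y)/\mathrm{Pr}(Y)$, where $\mathrm{Div}^0(Y)$ is the $\mathbb{Z}_p$-module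 of divisors $\sum_v a_v v$ ($a_v\in\mathbb{Z}_p$, $v\in V(Y)$) with $\sum_v a_v=0$, and $\mathrm{Pr}(Y)$ is the $\mathbb{Z}_p$-submodule generated by the divisors $\sum_{e}(v-t(e))$, $v\in V(Y)$, the sum running over all directed edges $e$ (every undirected edge being taken in both directions) with origin $v$ and $t(e)$ denoting the target of $e$. Let $J_\infty(X_\infty)=\varprojlim_m J(X_m)$, a module over $\Lambda=\mathbb{Z}_p[[T]]$, where $1+T$ acts through the translations $(v,g)\mapsto(v,g+1)$. Let $\mu(X_\infty)$ and $\lambda(X_\infty)$ be the Iwasawa invariants of this module: there is a $\Lambda$-linear map with pseudo-null kernel and cokernel from $J_\infty(X_\infty)$ to an elementary module $\bigoplus_i\Lambda/(p^{e_i})\oplus\bigoplus_j\Lambda/(g_j)$ with all $g_j$ coprime to $p$, and the characteristic power series $p^{\sum_i e_i}\prod_j g_j$ is associated with $p^{\mu(X_\infty)}G$ for a distinguished polynomial $G$ of degree $\lambda(X_\infty)$. Let $X_\infty\in\mathcal{E}^1(X)$. Then there exists an integer $m\ge 0$ such that the following hold. (a) For each $\tilde X_\infty\in\mathcal{E}^1(X_\infty,m)$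 we have $\mu(\tilde X_\infty)\le\mu(X_\infty)$. (b) For each $\tilde X_\infty\in\mathcal{E}^1(X_\infty,m)$ with $\mu(\tilde X_\infty)=\mu(X_\infty)$ we have $\lambda(\tilde X_\infty)=\lambda(X_\infty)$. -/

import Mathlib

open Polynomial

/-! ### Finite multigraphs and their Jacobians -/

/-- A multigraph with vertex set `V` and set of (undirected) edges `E`; loops and multiple edges are
allowed. Every undirected edge `e` comes with a chosen direction, from `src e` to `tgt e`
(that is, `E` is identified with a section `S` of the map from directed to undirected edges); the
oppositely directed edge `e⁻¹` runs from `tgt e` to `src e`. -/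
structure Multigraph (V E : Type*) where
  src : E → V
  tgt : E → V

namespace Multigraph

variable {V E W F : Type*}

/-- Two vertices are adjacent if some edge joins them, in either direction. -/
def Adj (G : Multigraph V E) (v w : V) : Prop :=
  ∃ e, (G.src e = v ∧ G.tgt e = w) ∨ (G.tgt e = v ∧ G.src e = w)

/-- A multigraph is connected if it is non-empty and any two vertices are joined by a path. -/
def Connected (G : Multigraph V E) : Prop :=
  Nonempty V ∧ ∀ v w, Relation.ReflTransGen G.Adj v w

variable (R : Type*) [CommRing R]

/-- The divisor module `Div(Y)` of finite formal sums `∑ a_v v` of vertices, with coefficients in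
`R`. -/
def Divisors (R : Type*) [CommRing R] (V : Type*) : Type _ := V →₀ R

noncomputable instance : AddCommGroup (Divisors R V) := inferInstanceAs (AddCommGroup (V →₀ R))

noncomputable instance : Module R (Divisors R V) := inferInstanceAs (Module R (V →₀ R))

/-- The vertex `v`, regarded as a divisor. -/
noncomputable def vertexDivisor (v : V) : Divisors R V := Finsupp.single v (1 : R)

/-- The map `∑ a_v v ↦ ∑ a_v f(v)` on divisors induced by a map `f` on vertices. -/
noncomputable def divisorMap (f : V → W) : Divisors R V →ₗ[R] Divisors R W :=
  Finsupp.lmapDomain R R f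

/-- The degree map `Div(Y) → R`, `∑ a_v v ↦ ∑ a_v`. -/
noncomputable def degMap (V : Type*) : Divisors R V →ₗ[R] R :=
  Finsupp.linearCombination R (fun _ => (1 : R))

theorem divisorMap_vertexDivisor (f : V → W) (v : V) :
    divisorMap R f (vertexDivisor R v) = vertexDivisor R (f v) :=
  Finsupp.mapDomain_single

theorem degMap_vertexDivisor (v : V) : degMap R V (vertexDivisor R v) = 1 :=
  (Finsupp.linearCombination_single R (1 : R) v).trans (one_smul R 1)

theorem divisorMap_divisorMap {U : Type*} (f : V → W) (g : W → U) (x : Divisors R V) :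
    divisorMap R g (divisorMap R f x) = divisorMap R (g ∘ f) x :=
  (Finsupp.mapDomain_comp (v := (x : V →₀ R))).symm

theorem divisorMap_id (x : Divisors R V) : divisorMap R id x = x :=
  Finsupp.mapDomain_id (v := (x : V →₀ R))

/-- The module `Div⁰(Y)` of divisors of degree zero. -/
noncomputable def Div0 (V : Type*) : Submodule R (Divisors R V) :=
  LinearMap.ker (degMap R V)

open Classical in
/-- The principal divisor `p_v = deg(v) v - ∑_{w ≠ v} mult(v, w) w - 2 #{loops at v} v`, written as
the sum of `v - t(e)` over all directed edges `e` with origin `v`. (A loop at `v` gives rise to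
two directed edges, each of which contributes `v - v = 0`.) -/
noncomputable def firing [Fintype E] (G : Multigraph V E) (v : V) : Divisors R V :=
  (∑ e ∈ Finset.univ.filter (fun e => G.src e = v),
      (vertexDivisor R v - vertexDivisor R (G.tgt e))) +
  (∑ e ∈ Finset.univ.filter (fun e => G.tgt e = v),
      (vertexDivisor R v - vertexDivisor R (G.src e)))

/-- The module `Pr(Y)` of principal divisors. -/
noncomputable def Pr [Fintype E] (G : Multigraph V E) : Submodule R (Divisors R V) :=
  Submodule.span R (Set.range (G.firing R))

/-- The Jacobian `J(Y) = Div⁰(Y) / Pr(Y)`. (As `Pr(Y) ⊆ Div⁰(Y)`, see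
`Pr_le_Div0`, nothing is lost in passing to the preimage of `Pr(Y)` in `Div⁰(Y)`.) For
`R = ℤ_p` and a finite connected graph this is the `p`-part of the usual Jacobian. -/
abbrev Jacobian [Fintype E] (G : Multigraph V E) : Type _ :=
  (Div0 R V) ⧸ (G.Pr R).submoduleOf (Div0 R V)

theorem Pr_le_Div0 [Fintype E] (G : Multigraph V E) : G.Pr R ≤ Div0 R V := by
  refine Submodule.span_le.2 ?_
  rintro _ ⟨v, rfl⟩
  simp [Div0, firing, degMap_vertexDivisor]

theorem degMap_divisorMap (f : V → W) (x : Divisors R V) :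
    degMap R W (divisorMap R f x) = degMap R V x :=
  Finsupp.linearCombination_mapDomain R f (x : V →₀ R)

/-- The map `Div⁰(Y) → Div⁰(Y')` induced by a map on vertices. -/
noncomputable def div0Map (f : V → W) : Div0 R V →ₗ[R] Div0 R W :=
  (divisorMap R f).restrict fun x hx => by
    
    have hx' : degMap R V x = 0 := hx
    exact (degMap_divisorMap R f x).trans hx'

theorem div0Map_div0Map {U : Type*} (f : V → W) (g : W → U) (x : Div0 R V) :
    div0Map R g (div0Map R f x) = div0Map R (g ∘ f) x :=
  Subtype.ext (divisorMap_divisorMap R f g x)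

theorem div0Map_id (x : Div0 R V) : div0Map R id x = x :=
  Subtype.ext (divisorMap_id R (x : Divisors R V))

/-- A covering of multigraphs (respecting the chosen directions): a homomorphism which is bijective
on the directed edges with a given origin. -/
structure IsCovering (G : Multigraph V E) (H : Multigraph W F) (f : V → W) (φ : E → F) : Prop where
  src : ∀ e, H.src (φ e) = f (G.src e)
  tgt : ∀ e, H.tgt (φ e) = f (G.tgt e)
  lift_src : ∀ v e', H.src e' = f v → ∃! e, G.src e = v ∧ φ e = e'
  lift_tgt : ∀ v e', H.tgt e' = f v → ∃! e, G.tgt e = v ∧ φ e = e'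

theorem IsCovering.map_firing [Fintype E] [Fintype F] {G : Multigraph V E} {H : Multigraph W F}
    {f : V → W} {φ : E → F} (h : G.IsCovering H f φ) (v : V) :
    divisorMap R f (G.firing R v) = H.firing R (f v) := by
  classical
  simp only [firing, map_add, map_sum, map_sub, divisorMap_vertexDivisor]
  congr 1
  · refine Finset.sum_nbij φ ?_ ?_ ?_ ?_
    · intro e he
      simp only [Finset.mem_filter, Finset.mem_univ, true_and] at he ⊢
      rw [h.src, he]
    · intro e he e' he' hee
      simp only [Finset.coe_filter, Finset.mem_univ, true_and, Set.mem_ofPred_eq] at he he'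
      exact (h.lift_src v (φ e) (by rw [h.src, he])).unique ⟨he, rfl⟩ ⟨he', hee.symm⟩
    · intro e' he'
      simp only [Finset.coe_filter, Finset.mem_univ, true_and, Set.mem_ofPred_eq] at he'
      obtain ⟨e, ⟨he, rfl⟩, -⟩ := h.lift_src v e' he'
      exact ⟨e, by simpa using he, rfl⟩
    · intro e _
      rw [h.tgt]
  · refine Finset.sum_nbij φ ?_ ?_ ?_ ?_
    · intro e he
      simp only [Finset.mem_filter, Finset.mem_univ, true_and] at he ⊢
      rw [h.tgt, he]
    · intro e he e' he' hee
      simp only [Finset.coe_filter, Finset.mem_univ, true_and, Set.mem_ofPred_eq] at he he'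
      exact (h.lift_tgt v (φ e) (by rw [h.tgt, he])).unique ⟨he, rfl⟩ ⟨he', hee.symm⟩
    · intro e' he'
      simp only [Finset.coe_filter, Finset.mem_univ, true_and, Set.mem_ofPred_eq] at he'
      obtain ⟨e, ⟨he, rfl⟩, -⟩ := h.lift_tgt v e' he'
      exact ⟨e, by simpa using he, rfl⟩
    · intro e _
      rw [h.src]

theorem IsCovering.map_Pr [Fintype E] [Fintype F] {G : Multigraph V E} {H : Multigraph W F}
    {f : V → W} {φ : E → F} (h : G.IsCovering H f φ) :
    (G.Pr R).submoduleOf (Div0 R V) ≤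
      ((H.Pr R).submoduleOf (Div0 R W)).comap (div0Map R f) := by
  have key : G.Pr R ≤ (H.Pr R).comap (divisorMap R f) := by
    refine Submodule.span_le.2 ?_
    rintro _ ⟨v, rfl⟩
    simp only [Submodule.comap_coe, Set.mem_preimage, SetLike.mem_coe]
    rw [h.map_firing R v]
    exact Submodule.subset_span ⟨f v, rfl⟩
  intro x hx
  exact key hx

/-- The map on Jacobians induced by a covering, given by `∑ a_v v ↦ ∑ a_v f(v)` on divisors. -/
noncomputable def IsCovering.jacobianMap [Fintype E] [Fintype F] {G : Multigraph V E}
    {H : Multigraph W F} {f : V → W} {φ : E → F} (h : G.IsCovering H f φ) :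
    G.Jacobian R →ₗ[R] H.Jacobian R :=
  Submodule.mapQ _ _ (div0Map R f) (h.map_Pr R)

/-! ### Voltage covers -/

variable {p : ℕ} [Fact p.Prime]

/-- The `m`-th derived graph `X_m = X(ℤ/p^m, S, α_m)` of a voltage assignment `α : S → ℤ_p` with
reduction `α_m : S → ℤ/p^m`: its vertices are the pairs `(v, g)`, and every edge `e` of `X` and
every `g ∈ ℤ/p^m` give an edge from `(src e, g)` to `(tgt e, g + α_m(e))`. -/
noncomputable def derived (X : Multigraph V E) (α : E → ℤ_[p]) (m : ℕ) :
    Multigraph (V × ZMod (p ^ m)) (E × ZMod (p ^ m)) where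
  src e := (X.src e.1, e.2)
  tgt e := (X.tgt e.1, e.2 + PadicInt.toZModPow m (α e.1))

/-- The set `𝓔¹(X)` of voltage `ℤ_p`-covers of `X`, given by their voltage assignments. As always
in this theory, all the intermediate graphs `X_m` of a `ℤ_p`-cover are required to be connected
(so that `X_m / X` is a Galois cover with group `ℤ/p^m`). -/
def voltageCovers (p : ℕ) [Fact p.Prime] (X : Multigraph V E) : Set (E → ℤ_[p]) :=
  {α | ∀ m, (X.derived α m).Connected}

/-- The neighbourhood `𝓔¹(X_∞, m)` of the cover `X_∞` defined by `α`: the set of all covers whose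
voltage assignment `α'` satisfies `α'_m = α_m`. -/
def coverNhd (X : Multigraph V E) (α : E → ℤ_[p]) (m : ℕ) : Set (E → ℤ_[p]) :=
  {α' | α' ∈ X.voltageCovers p ∧
    ∀ e, PadicInt.toZModPow m (α' e) = PadicInt.toZModPow m (α e)}

/-- Translation by the generator `1 ∈ ℤ/p^m` is an automorphism of `X_m`. -/
theorem isCovering_shift (X : Multigraph V E) (α : E → ℤ_[p]) (m : ℕ) :
    (X.derived α m).IsCovering (X.derived α m)
      (fun x => (x.1, x.2 + 1)) (fun e => (e.1, e.2 + 1)) where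
  src e := rfl
  tgt e := by simp only [derived]; rw [add_right_comm]
  lift_src := by
    rintro ⟨v, g⟩ ⟨e, k⟩ h
    simp only [derived, Prod.mk.injEq] at h
    refine ⟨(e, g), ⟨by simp [derived, h.1], by simp [h.2]⟩, ?_⟩
    rintro ⟨e', k'⟩ ⟨h1, h2⟩
    simp only [derived, Prod.mk.injEq] at h1 h2 ⊢
    exact ⟨h2.1, h1.2⟩
  lift_tgt := by
    rintro ⟨v, g⟩ ⟨e, k⟩ h
    simp only [derived, Prod.mk.injEq] at h
    refine ⟨(e, k - 1), ⟨?_, by simp⟩, ?_⟩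
    · simp only [derived, Prod.mk.injEq]
      refine ⟨h.1, ?_⟩
      rw [sub_add_eq_add_sub, h.2, add_sub_cancel_right]
    · rintro ⟨e', k'⟩ ⟨h1, h2⟩
      simp only [Prod.mk.injEq] at h2 ⊢
      exact ⟨h2.1, by rw [← h2.2, add_sub_cancel_right]⟩

/-- The projection `ℤ/p^(m+1) → ℤ/p^m`. -/
def zmodProj (p m : ℕ) : ZMod (p ^ (m + 1)) →+* ZMod (p ^ m) :=
  ZMod.castHom (pow_dvd_pow p m.le_succ) (ZMod (p ^ m))

theorem zmodProj_toZModPow (m : ℕ) (a : ℤ_[p]) :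
    zmodProj p m (PadicInt.toZModPow (m + 1) a) = PadicInt.toZModPow m a := by
  have := PadicInt.zmod_cast_comp_toZModPow (p := p) m (m + 1) m.le_succ
  exact congrArg (fun f => f a) this

/-- The projection `X_{m+1} → X_m` is a covering. -/
theorem isCovering_proj (X : Multigraph V E) (α : E → ℤ_[p]) (m : ℕ) :
    (X.derived α (m + 1)).IsCovering (X.derived α m)
      (fun x => (x.1, zmodProj p m x.2)) (fun e => (e.1, zmodProj p m e.2)) where
  src e := rfl
  tgt e := by simp only [derived, map_add, zmodProj_toZModPow]
  lift_src := by
    rintro ⟨v, g⟩ ⟨e, k⟩ h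
    simp only [derived, Prod.mk.injEq] at h
    refine ⟨(e, g), ⟨by simp [derived, h.1], by simp [h.2]⟩, ?_⟩
    rintro ⟨e', k'⟩ ⟨h1, h2⟩
    simp only [derived, Prod.mk.injEq] at h1 h2 ⊢
    exact ⟨h2.1, h1.2⟩
  lift_tgt := by
    rintro ⟨v, g⟩ ⟨e, k⟩ h
    simp only [derived, Prod.mk.injEq] at h
    refine ⟨(e, g - PadicInt.toZModPow (m + 1) (α e)), ⟨by simp [derived, h.1], ?_⟩, ?_⟩
    · simp only [map_sub, zmodProj_toZModPow, ← h.2, add_sub_cancel_right]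
    · rintro ⟨e', k'⟩ ⟨h1, h2⟩
      simp only [derived, Prod.mk.injEq] at h1 h2 ⊢
      refine ⟨h2.1, ?_⟩
      rw [← h1.2, h2.1, add_sub_cancel_right]

end Multigraph

/-! ### The Iwasawa algebra and its action on modules with an action of `ℤ/p^m` -/

section Iwasawa

variable (p : ℕ) [Fact p.Prime]

/-- The polynomial `ω_m(T) = (T + 1)^(p^m) - 1`. -/
noncomputable def omegaPoly (m : ℕ) : ℤ_[p][X] := (X + 1) ^ (p ^ m) - 1

theorem omegaPoly_isDistinguishedAt (m : ℕ) :
    (omegaPoly p m).IsDistinguishedAt (IsLocalRing.maximalIdeal ℤ_[p]) := by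
  have hpm : 0 < p ^ m := pow_pos (Fact.out : p.Prime).pos m
  have hmon : ((X + 1 : ℤ_[p][X]) ^ (p ^ m)).Monic := by
    have := (monic_X_add_C (1 : ℤ_[p])).pow (p ^ m)
    simpa using this
  have hdeg : ((X + 1 : ℤ_[p][X]) ^ (p ^ m)).degree = (p ^ m : ℕ) := by
    have h1 : (X + 1 : ℤ_[p][X]).degree = 1 := by simpa using degree_X_add_C (1 : ℤ_[p])
    rw [degree_pow, h1]; simp
  have hlt : (1 : ℤ_[p][X]).degree < ((X + 1 : ℤ_[p][X]) ^ (p ^ m)).degree := by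
    rw [hdeg, degree_one]
    exact_mod_cast hpm
  have hnat : (omegaPoly p m).natDegree = p ^ m := by
    apply natDegree_eq_of_degree_eq_some
    rw [omegaPoly, degree_sub_eq_left_of_degree_lt hlt, hdeg]
  refine { monic := hmon.sub_of_left hlt, mem := ?_ }
  intro n hn
  rw [hnat] at hn
  rw [PadicInt.maximalIdeal_eq_span_p, Ideal.mem_span_singleton]
  rw [omegaPoly, coeff_sub, coeff_X_add_one_pow, coeff_one]
  rcases Nat.eq_zero_or_pos n with rfl | hn0
  · simp
  · rw [if_neg hn0.ne', sub_zero]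
    exact_mod_cast Nat.cast_dvd_cast (α := ℤ_[p])
      ((Fact.out : p.Prime).dvd_choose_pow hn0.ne' hn.ne)

variable {p}
variable {M N : Type*} [AddCommGroup M] [Module ℤ_[p] M] [AddCommGroup N] [Module ℤ_[p] N]

theorem aeval_omegaPoly {m : ℕ} {γ : Module.End ℤ_[p] M} (h : γ ^ (p ^ m) = 1) :
    aeval (γ - 1) (omegaPoly p m) = 0 := by
  simp [omegaPoly, h]

/-- Let `γ` be an endomorphism of `M` with `γ^(p^m) = 1`. Then the Iwasawa algebra
`Λ = ℤ_p⟦T⟧` acts on `M` through its quotient `Λ/(ω_m) = ℤ_p[T]/(ω_m) = ℤ_p[ℤ/p^m]`, where `T`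
acts as `γ - 1`. -/
noncomputable def iwasawaAction {m : ℕ} {γ : Module.End ℤ_[p] M} (h : γ ^ (p ^ m) = 1) :
    PowerSeries ℤ_[p] →+* Module.End ℤ_[p] M :=
  (Ideal.Quotient.lift (Ideal.span {omegaPoly p m})
      (aeval (R := ℤ_[p]) (γ - 1)).toRingHom (fun a ha => by
        obtain ⟨b, rfl⟩ := Ideal.mem_span_singleton'.1 ha
        simp [aeval_omegaPoly h])).comp
    (((omegaPoly_isDistinguishedAt p m).algEquivQuotient.symm.toRingEquiv.toRingHom).comp
      (Ideal.Quotient.mk (Ideal.span {(omegaPoly p m : PowerSeries ℤ_[p])})))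

theorem iwasawaAction_coe {m : ℕ} {γ : Module.End ℤ_[p] M} (h : γ ^ (p ^ m) = 1) (q : ℤ_[p][X]) :
    iwasawaAction h (q : PowerSeries ℤ_[p]) = aeval (γ - 1) q := by
  have : (omegaPoly_isDistinguishedAt p m).algEquivQuotient.symm
      (Ideal.Quotient.mk (Ideal.span {(omegaPoly p m : PowerSeries ℤ_[p])}) q)
      = Ideal.Quotient.mk _ q := by
    rw [AlgEquiv.symm_apply_eq, Polynomial.IsDistinguishedAt.algEquivQuotient_apply]
    simp
  simp only [iwasawaAction, RingHom.comp_apply]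
  erw [this]
  simp

theorem iwasawaAction_X {m : ℕ} {γ : Module.End ℤ_[p] M} (h : γ ^ (p ^ m) = 1) :
    iwasawaAction h (PowerSeries.X : PowerSeries ℤ_[p]) = γ - 1 := by
  rw [← Polynomial.coe_X, iwasawaAction_coe, aeval_X]

/-- Equivariant maps are compatible with the action of `Λ`. -/
theorem iwasawaAction_comm {m n : ℕ} {γ : Module.End ℤ_[p] M} (h : γ ^ (p ^ m) = 1)
    {δ : Module.End ℤ_[p] N} (h' : δ ^ (p ^ n) = 1) (hnm : n ≤ m) (π : M →ₗ[ℤ_[p]] N)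
    (hπ : ∀ x, π (γ x) = δ (π x)) (f : PowerSeries ℤ_[p]) (x : M) :
    π (iwasawaAction h f x) = iwasawaAction h' f (π x) := by
  obtain ⟨q, hq⟩ := Ideal.Quotient.mk_surjective
    ((omegaPoly_isDistinguishedAt p m).algEquivQuotient.symm
      (Ideal.Quotient.mk (Ideal.span {(omegaPoly p m : PowerSeries ℤ_[p])}) f))
  have hq' : Ideal.Quotient.mk (Ideal.span {(omegaPoly p m : PowerSeries ℤ_[p])})
      (q : PowerSeries ℤ_[p]) = Ideal.Quotient.mk _ f := by
    rw [AlgEquiv.eq_symm_apply, Polynomial.IsDistinguishedAt.algEquivQuotient_apply] at hq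
    simpa using hq
  obtain ⟨b, hb⟩ := Ideal.mem_span_singleton'.1 (Ideal.Quotient.eq.1 hq'.symm)
  have hf : f = q + b * (omegaPoly p m : PowerSeries ℤ_[p]) := by rw [hb]; ring
  have h'' : δ ^ (p ^ m) = 1 := by
    obtain ⟨k, rfl⟩ := Nat.exists_eq_add_of_le hnm
    rw [pow_add, pow_mul, h', one_pow]
  have key : ∀ (q : ℤ_[p][X]) (x : M),
      π (aeval (γ - 1) q x) = aeval (δ - 1) q (π x) := by
    intro q
    induction q using Polynomial.induction_on' with
    | add a b ha hb => intro x; simp [ha, hb]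
    | monomial k a =>
      intro x
      simp only [aeval_monomial, Module.End.mul_apply, Module.algebraMap_end_apply, map_smul]
      congr 1
      induction k generalizing x with
      | zero => simp
      | succ k ih => rw [pow_succ, pow_succ, Module.End.mul_apply, Module.End.mul_apply, ih]; simp [hπ]
  rw [hf, map_add, map_add, map_mul, map_mul, iwasawaAction_coe, iwasawaAction_coe,
    iwasawaAction_coe, iwasawaAction_coe, aeval_omegaPoly h, aeval_omegaPoly h'', mul_zero,
    mul_zero, add_zero, add_zero, key]

end Iwasawa

/-! ### The Iwasawa module of a voltage cover -/

namespace Multigraph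

variable {V E : Type*} [Fintype E] {p : ℕ} [Fact p.Prime]

/-- The Jacobian `J(X_m)` of the `m`-th graph of the cover. -/
def LevelJacobian (X : Multigraph V E) (α : E → ℤ_[p]) (m : ℕ) : Type _ :=
  (X.derived α m).Jacobian ℤ_[p]

variable (X : Multigraph V E) (α : E → ℤ_[p]) (m : ℕ)

noncomputable instance : AddCommGroup (X.LevelJacobian α m) :=
  inferInstanceAs (AddCommGroup ((X.derived α m).Jacobian ℤ_[p]))

noncomputable instance : Module ℤ_[p] (X.LevelJacobian α m) :=
  inferInstanceAs (Module ℤ_[p] ((X.derived α m).Jacobian ℤ_[p]))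

/-- The action of the topological generator `γ = 1` of `ℤ_p` on `J(X_m)`, induced by
`(v, g) ↦ (v, g + 1)`. -/
noncomputable def levelShift : Module.End ℤ_[p] (X.LevelJacobian α m) :=
  (X.isCovering_shift α m).jacobianMap ℤ_[p]

/-- The natural map `J(X_{m+1}) → J(X_m)`. -/
noncomputable def levelProj : X.LevelJacobian α (m + 1) →ₗ[ℤ_[p]] X.LevelJacobian α m :=
  (X.isCovering_proj α m).jacobianMap ℤ_[p]

/-- The quotient map `Div⁰(X_m) → J(X_m)`. -/
noncomputable def levelMk :
    Div0 ℤ_[p] (V × ZMod (p ^ m)) →ₗ[ℤ_[p]] X.LevelJacobian α m :=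
  Submodule.mkQ (((X.derived α m).Pr ℤ_[p]).submoduleOf (Div0 ℤ_[p] (V × ZMod (p ^ m))))

theorem levelMk_surjective : Function.Surjective (levelMk X α m) :=
  Submodule.mkQ_surjective _

theorem levelShift_mk (x : Div0 ℤ_[p] (V × ZMod (p ^ m))) :
    levelShift X α m (levelMk X α m x) =
      levelMk X α m (div0Map ℤ_[p] (fun y => (y.1, y.2 + 1)) x) := rfl

theorem levelProj_mk (x : Div0 ℤ_[p] (V × ZMod (p ^ (m + 1)))) :
    levelProj X α m (levelMk X α (m + 1) x) =
      levelMk X α m (div0Map ℤ_[p] (fun y => (y.1, zmodProj p m y.2)) x) := rfl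

theorem levelShift_pow : levelShift X α m ^ (p ^ m) = 1 := by
  have key : ∀ (k : ℕ) (x : Div0 ℤ_[p] (V × ZMod (p ^ m))),
      (levelShift X α m ^ k) (levelMk X α m x) =
        levelMk X α m (div0Map ℤ_[p] (fun y => (y.1, y.2 + (k : ZMod (p ^ m)))) x) := by
    intro k
    induction k with
    | zero =>
      intro x
      simp only [pow_zero, Module.End.one_apply, Nat.cast_zero, add_zero]
      rw [show (fun y : V × ZMod (p ^ m) => (y.1, y.2)) = id from rfl, div0Map_id]
    | succ k ih =>
      intro x
      rw [pow_succ, Module.End.mul_apply, levelShift_mk, ih, div0Map_div0Map]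
      congr 3
      funext y
      simp [add_comm, add_left_comm]
  refine LinearMap.ext fun y => ?_
  obtain ⟨x, rfl⟩ := levelMk_surjective X α m y
  rw [key (p ^ m) x, Module.End.one_apply]
  simp only [ZMod.natCast_self, add_zero]
  rw [show (fun y : V × ZMod (p ^ m) => (y.1, y.2)) = id from rfl, div0Map_id]

theorem levelProj_levelShift (x : X.LevelJacobian α (m + 1)) :
    levelProj X α m (levelShift X α (m + 1) x) = levelShift X α m (levelProj X α m x) := by
  obtain ⟨x, rfl⟩ := levelMk_surjective X α (m + 1) x
  rw [levelShift_mk, levelProj_mk, levelProj_mk, levelShift_mk, div0Map_div0Map, div0Map_div0Map]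
  congr 3
  funext y
  simp

/-- The structure of a `Λ`-module on `J(X_m)`, with `T` acting as `γ - 1`. -/
noncomputable instance : Module (PowerSeries ℤ_[p]) (X.LevelJacobian α m) :=
  Module.compHom _ (iwasawaAction (levelShift_pow X α m))

theorem powerSeries_smul_def (f : PowerSeries ℤ_[p]) (x : X.LevelJacobian α m) :
    f • x = iwasawaAction (levelShift_pow X α m) f x := rfl

/-- The Iwasawa module `J_∞(X_∞) = lim J(X_m)` over `Λ = ℤ_p⟦T⟧`, the projective limit of the
Jacobians of the intermediate graphs. -/
noncomputable def iwasawaJacobian : Submodule (PowerSeries ℤ_[p]) (∀ m, X.LevelJacobian α m) where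
  carrier := {x | ∀ m, levelProj X α m (x (m + 1)) = x m}
  add_mem' := by
    intro x y hx hy m
    simp [hx m, hy m]
  zero_mem' := by
    intro m
    simp
  smul_mem' := by
    intro f x hx m
    rw [Pi.smul_apply, Pi.smul_apply, powerSeries_smul_def, powerSeries_smul_def,
      iwasawaAction_comm _ (levelShift_pow X α m) m.le_succ _ (levelProj_levelShift X α m), hx m]

end Multigraph

/-! ### Iwasawa invariants of `Λ`-modules -/

section Invariants

/-- A module is pseudo-null if it is annihilated by two relatively prime elements. -/
def IsPseudoNull (R M : Type*) [CommRing R] [AddCommGroup M] [Module R M] : Prop :=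
  ∃ a b : R, IsRelPrime a b ∧ (∀ x : M, a • x = 0) ∧ ∀ x : M, b • x = 0

/-- A pseudo-isomorphism is a homomorphism with pseudo-null kernel and cokernel. -/
def IsPseudoIsomorphism {R M N : Type*} [CommRing R] [AddCommGroup M] [Module R M]
    [AddCommGroup N] [Module R N] (φ : M →ₗ[R] N) : Prop :=
  IsPseudoNull R (LinearMap.ker φ) ∧ IsPseudoNull R (N ⧸ LinearMap.range φ)

variable (p : ℕ) [Fact p.Prime]

/-- The elementary `Λ`-module `⨁ Λ/(p^(e_i)) ⊕ ⨁ Λ/(g_j)`. -/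
abbrev ElementaryModule {s t : ℕ} (e : Fin s → ℕ) (g : Fin t → PowerSeries ℤ_[p]) : Type :=
  (∀ i, PowerSeries ℤ_[p] ⧸ Ideal.span {(p : PowerSeries ℤ_[p]) ^ e i}) ×
    (∀ j, PowerSeries ℤ_[p] ⧸ Ideal.span {g j})

/-- `F` is a characteristic power series of the `Λ`-module `A`: there is a pseudo-isomorphism from
`A` to an elementary module `⨁ Λ/(p^(e_i)) ⊕ ⨁ Λ/(g_j)`, the `g_j` being coprime with `p`, such
that `F = p^(∑ e_i) ∏ g_j`. -/
def IsCharPowerSeries (A : Type*) [AddCommGroup A] [Module (PowerSeries ℤ_[p]) A]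
    (F : PowerSeries ℤ_[p]) : Prop :=
  ∃ (s t : ℕ) (e : Fin s → ℕ) (g : Fin t → PowerSeries ℤ_[p]),
    (∀ j, IsRelPrime (g j) (p : PowerSeries ℤ_[p])) ∧
    (∃ φ : A →ₗ[PowerSeries ℤ_[p]] ElementaryModule p e g, IsPseudoIsomorphism φ) ∧
    F = (p : PowerSeries ℤ_[p]) ^ (∑ i, e i) * ∏ j, g j

/-- The `Λ`-module `A` has Iwasawa invariants `μ` and `λ = l`: a characteristic power series of `A`
is associated with `p^μ G`, where `G` is a distinguished polynomial of degree `l`. -/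
def HasIwasawaInvariants (A : Type*) [AddCommGroup A] [Module (PowerSeries ℤ_[p]) A]
    (μ l : ℕ) : Prop :=
  ∃ F, IsCharPowerSeries p A F ∧ ∃ G : ℤ_[p][X],
    G.IsDistinguishedAt (IsLocalRing.maximalIdeal ℤ_[p]) ∧ G.natDegree = l ∧
    Associated F ((p : PowerSeries ℤ_[p]) ^ μ * (G : PowerSeries ℤ_[p]))

open Classical in
/-- The pair `(μ(A), λ(A))` of Iwasawa invariants of a finitely generated torsion `Λ`-module `A`
(for which it exists and is unique; the value `(0, 0)` is a dummy value for other modules). -/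
noncomputable def iwasawaInvariants (A : Type*) [AddCommGroup A] [Module (PowerSeries ℤ_[p]) A] :
    ℕ × ℕ :=
  if h : ∃ q : ℕ × ℕ, HasIwasawaInvariants p A q.1 q.2 then h.choose else (0, 0)

end Invariants

namespace Multigraph

variable {V E : Type*} [Fintype E] {p : ℕ} [Fact p.Prime]

/-- `μ(X_∞)`, the `μ`-invariant of `J_∞(X_∞)`. -/
noncomputable def muInvariant (X : Multigraph V E) (α : E → ℤ_[p]) : ℕ :=
  (iwasawaInvariants p (X.iwasawaJacobian α)).1

/-- `λ(X_∞)`, the `λ`-invariant of `J_∞(X_∞)`. -/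
noncomputable def lambdaInvariant (X : Multigraph V E) (α : E → ℤ_[p]) : ℕ :=
  (iwasawaInvariants p (X.iwasawaJacobian α)).2

end Multigraph

/-! Over `Λ` the whole tower is governed by one matrix, the voltage Laplacian `D - A_α`, in which an
edge `e` enters through `(1 + T) ^ α(e)`. Sending a basis vector to the vertex `(v, 0)` identifies
`Div(X_m)` with `(Λ/ω_m)^V` and the Laplacian of `X_m` with the reduction of this matrix
(`theta_surjective`, `omegaPoly_dvd_of_theta_eq_zero`, `levelLaplacian_theta`). In the limit, `J_∞`
is the module of degree-zero vectors in `Λ^V` modulo the image of the matrix. The degree-zero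
vectors form a free module, embedded in `Λ^V` with determinant `T`, so `J_∞` is the cokernel of a
square matrix `P` with `T * det P = det (D - A_α)` (`nonempty_iwasawaJacobian_equiv`).

This determinant is nonzero: a kernel vector would give a constant divisor on every connected `X_m`,
of a degree independent of `m` and divisible by every `p^m` (`voltageLaplacian_det_ne_zero`). A
structure theorem up to pseudo-isomorphism, and the invariance of determinants of presentation
matrices under pseudo-isomorphism, show that every characteristic power series of `J_∞` is
associated with `det P` (`IsCharPowerSeries.associated_det`).

It remains to see that the invariants vary semicontinuously. If `α' ≡ α` mod `p^m`, the two
Laplacian determinants agree modulo `ω_m`, which lies in the `(m+1)`-st power of the maximal ideal,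
so the low coefficients of `det P` agree modulo a high power of `p`. Now `p^μ` is the exact power of
`p` dividing all coefficients, and `λ` is the first index whose coefficient is not divisible by
`p^(μ+1)`. Agreement modulo `p^(μ+1)` up to index `λ` thus bounds `μ'` by `μ` and fixes `λ` when `μ'
= μ` (`invariants_le_of_coeff_sub`). Coefficients beyond `λ` stay uncontrolled, but they cannot
raise `μ'` above `μ`. -/

section Commutative

/-! ### Cokernels of matrices and inverses up to a scalar -/

variable {A : Type*} [CommRing A]

/-- Lift `φ` and `ψ` to matrices `F` and `G`. Since `ψ ∘ φ = s`, both `s - G F` and `G Q` have all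
columns in the image of `P`, say `P Z1` and `P Z2`. These identities combine into one equation
between products of block matrices, and taking determinants gives the divisibility. -/
theorem Matrix.det_dvd_pow_mul_det {m n : Type*} [Fintype m] [Fintype n] [DecidableEq m]
    [DecidableEq n] {P : Matrix n n A} {Q : Matrix m m A} (s : A)
    (φ : ((n → A) ⧸ LinearMap.range P.mulVecLin) →ₗ[A] ((m → A) ⧸ LinearMap.range Q.mulVecLin))
    (ψ : ((m → A) ⧸ LinearMap.range Q.mulVecLin) →ₗ[A] ((n → A) ⧸ LinearMap.range P.mulVecLin))
    (h : ∀ x, ψ (φ x) = s • x) : P.det ∣ s ^ Fintype.card n * Q.det := by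
  have hlift : ∀ i, ∃ u : m → A,
      (LinearMap.range Q.mulVecLin).mkQ u = φ ((LinearMap.range P.mulVecLin).mkQ (Pi.single i 1)) :=
    fun i => Submodule.mkQ_surjective _ _
  have hlift' : ∀ j, ∃ u : n → A,
      (LinearMap.range P.mulVecLin).mkQ u = ψ ((LinearMap.range Q.mulVecLin).mkQ (Pi.single j 1)) :=
    fun i => Submodule.mkQ_surjective _ _
  choose f hf using hlift
  choose g hg using hlift'
  let F : Matrix m n A := Matrix.of fun j i => f i j
  let G : Matrix n m A := Matrix.of fun i j => g j i
  have hF : ∀ x : n → A, (LinearMap.range Q.mulVecLin).mkQ (F.mulVec x) =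
      φ ((LinearMap.range P.mulVecLin).mkQ x) := by
    have : (LinearMap.range Q.mulVecLin).mkQ ∘ₗ F.mulVecLin =
        φ ∘ₗ (LinearMap.range P.mulVecLin).mkQ := by
      refine LinearMap.pi_ext' fun i => LinearMap.ext_ring ?_
      have e : F.mulVec (Pi.single i 1) = f i := by ext j; simp [F]
      simpa [e] using hf i
    exact fun x => LinearMap.congr_fun this x
  have hG : ∀ x : m → A, (LinearMap.range P.mulVecLin).mkQ (G.mulVec x) =
      ψ ((LinearMap.range Q.mulVecLin).mkQ x) := by
    have : (LinearMap.range P.mulVecLin).mkQ ∘ₗ G.mulVecLin =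
        ψ ∘ₗ (LinearMap.range Q.mulVecLin).mkQ := by
      refine LinearMap.pi_ext' fun i => LinearMap.ext_ring ?_
      have e : G.mulVec (Pi.single i 1) = g i := by ext j; simp [G]
      simpa [e] using hg i
    exact fun x => LinearMap.congr_fun this x
  have h1 : ∀ i, ∃ z : n → A, P.mulVec z = s • Pi.single i 1 - G.mulVec (F.mulVec (Pi.single i 1)) := by
    intro i
    have : s • Pi.single i 1 - G.mulVec (F.mulVec (Pi.single i 1)) ∈ LinearMap.range P.mulVecLin := by
      rw [← Submodule.ker_mkQ (LinearMap.range P.mulVecLin), LinearMap.mem_ker, map_sub, hG, hF, h,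
        map_smul, sub_self]
    exact this
  have h2 : ∀ j, ∃ z : n → A, P.mulVec z = G.mulVec (Q.mulVec (Pi.single j 1)) := by
    intro j
    have : G.mulVec (Q.mulVec (Pi.single j 1)) ∈ LinearMap.range P.mulVecLin := by
      rw [← Submodule.ker_mkQ (LinearMap.range P.mulVecLin), LinearMap.mem_ker, hG]
      have : (LinearMap.range Q.mulVecLin).mkQ (Q.mulVec (Pi.single j 1)) = 0 := by
        rw [← LinearMap.mem_ker, Submodule.ker_mkQ]
        exact ⟨_, rfl⟩
      rw [this, map_zero]
    exact this
  choose z1 hz1 using h1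
  choose z2 hz2 using h2
  let Z1 : Matrix n n A := Matrix.of fun i j => z1 j i
  let Z2 : Matrix n m A := Matrix.of fun i j => z2 j i
  have e1 : P * Z1 = s • (1 : Matrix n n A) - G * F := by
    refine Matrix.ext_of_mulVec_single fun i => ?_
    have e : Z1.mulVec (Pi.single i 1) = z1 i := by ext j; simp [Z1]
    rw [← Matrix.mulVec_mulVec, e, hz1, Matrix.sub_mulVec, Matrix.smul_mulVec, Matrix.one_mulVec,
      ← Matrix.mulVec_mulVec]
  have e2 : P * Z2 = G * Q := by
    refine Matrix.ext_of_mulVec_single fun i => ?_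
    have e : Z2.mulVec (Pi.single i 1) = z2 i := by ext j; simp [Z2]
    rw [← Matrix.mulVec_mulVec, e, hz2, ← Matrix.mulVec_mulVec]
  have key : Matrix.fromBlocks (s • (1 : Matrix n n A)) G 0 1 * Matrix.fromBlocks 1 0 (-F) Q =
      Matrix.fromBlocks P 0 0 1 * Matrix.fromBlocks Z1 Z2 (-F) Q := by
    simp [Matrix.fromBlocks_multiply, e1, e2, sub_eq_add_neg]
  have := congrArg Matrix.det key
  rw [Matrix.det_mul, Matrix.det_mul, Matrix.det_fromBlocks_zero₂₁, Matrix.det_fromBlocks_zero₁₂,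
    Matrix.det_fromBlocks_zero₁₂, Matrix.det_smul] at this
  simp only [Matrix.det_one, mul_one, one_mul] at this
  exact ⟨_, this⟩

/-- A homomorphism whose kernel and cokernel are annihilated by `s` has an inverse up to `s * s`. -/
theorem LinearMap.exists_inverse_up_to_smul {M N : Type*} [AddCommGroup M] [Module A M]
    [AddCommGroup N] [Module A N] (φ : M →ₗ[A] N) (s : A) (hk : ∀ x ∈ LinearMap.ker φ, s • x = 0)
    (hc : ∀ y, s • y ∈ LinearMap.range φ) :
    ∃ ψ : N →ₗ[A] M, (∀ x, ψ (φ x) = (s * s) • x) ∧ ∀ y, φ (ψ y) = (s * s) • y := by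
  choose r hr using hc
  -- One factor `s` moves `y` into the image; the second makes the choice of a preimage irrelevant,
  -- which gives additivity and linearity of `ψ`.
  have uniq : ∀ x x', φ x = φ x' → s • x = s • x' := fun x x' h => by
    rw [← sub_eq_zero, ← smul_sub]
    exact hk _ (by simp [h])
  refine ⟨{ toFun := fun y => s • r y
            map_add' := fun y y' => ?_
            map_smul' := fun a y => ?_ }, fun x => ?_, fun y => ?_⟩
  · rw [← smul_add]
    exact uniq _ _ (by simp [hr])
  · rw [RingHom.id_apply, smul_comm a s]
    exact uniq _ _ (by simp [hr, smul_comm a s])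
  · rw [mul_smul]
    exact uniq _ _ (by simp [hr])
  · simp [hr, mul_smul]

/-- Maps out of a finitely presented module into a localization lift after clearing a denominator,
and two maps that agree after localization agree after multiplication by an element of `S`. The
factors `u` and `v` needed for the two composites are both put into `ψ`, so that one scalar serves
on both sides. -/
theorem Module.FinitePresentation.exists_inverse_up_to_smul (S : Submonoid A)
    {M N M' N' : Type*} [AddCommGroup M] [Module A M] [AddCommGroup N] [Module A N]
    [AddCommGroup M'] [Module A M'] [AddCommGroup N'] [Module A N']
    [Module.FinitePresentation A M] [Module.FinitePresentation A N]
    (f : M →ₗ[A] M') (g : N →ₗ[A] N') [IsLocalizedModule S f] [IsLocalizedModule S g]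
    (l : M' ≃ₗ[A] N') :
    ∃ (φ : M →ₗ[A] N) (ψ : N →ₗ[A] M), ∃ s ∈ S, (∀ x, ψ (φ x) = s • x) ∧ ∀ y, φ (ψ y) = s • y := by
  obtain ⟨φ, s, hφ⟩ := exists_lift_of_isLocalizedModule S g (l.toLinearMap ∘ₗ f)
  obtain ⟨ψ, t, hψ⟩ := exists_lift_of_isLocalizedModule S f (l.symm.toLinearMap ∘ₗ g)
  have hφ' : ∀ x, g (φ x) = (s : A) • l (f x) := fun x => LinearMap.congr_fun hφ x
  have hψ' : ∀ x, f (ψ x) = (t : A) • l.symm (g x) := fun x => LinearMap.congr_fun hψ x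
  obtain ⟨u, hu⟩ := Module.Finite.exists_smul_of_comp_eq_of_isLocalizedModule S f (ψ ∘ₗ φ)
    (((t : A) * s) • LinearMap.id) (by ext x; simp [hφ', hψ', mul_smul])
  obtain ⟨v, hv⟩ := Module.Finite.exists_smul_of_comp_eq_of_isLocalizedModule S g (φ ∘ₗ ψ)
    (((t : A) * s) • LinearMap.id) (by ext x; simp [hφ', hψ', mul_smul, smul_comm (s : A)])
  have hu' : ∀ x, (u : A) • ψ (φ x) = (u : A) • ((t : A) * s) • x := fun x => LinearMap.congr_fun hu x
  have hv' : ∀ x, (v : A) • φ (ψ x) = (v : A) • ((t : A) * s) • x := fun x => LinearMap.congr_fun hv x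
  refine ⟨φ, ((u : A) * v) • ψ, _, (u * v * (t * s)).2, fun x => ?_, fun y => ?_⟩
  · simp only [LinearMap.smul_apply, Submonoid.coe_mul]
    rw [mul_comm (u : A), mul_smul, hu', smul_smul, smul_smul, mul_assoc]
  · simp only [LinearMap.smul_apply, Submonoid.coe_mul, map_smul]
    rw [mul_smul, hv', smul_smul, smul_smul, mul_assoc]

end Commutative

/-! ### Factorial domains, localized at the elements prime to `H` -/

section UFD

variable {A : Type*} [CommRing A] [IsDomain A] [UniqueFactorizationMonoid A]

/-- After cancelling the common part of `a` and `b`, a prime `π` dividing what is left of `a` would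
have to divide `s`. Divisibility can thus be tested at one prime at a time. -/
theorem dvd_of_forall_prime_dvd_mul {a b : A} (ha : a ≠ 0) (hb : b ≠ 0)
    (h : ∀ π : A, Prime π → ∃ s, ¬ π ∣ s ∧ a ∣ s * b) : a ∣ b := by
  obtain ⟨a', b', c, hab, rfl, rfl⟩ := UniqueFactorizationMonoid.exists_reduced_factors' a b hb
  refine mul_dvd_mul_left c (IsUnit.dvd ?_)
  by_contra hu
  obtain ⟨π, hπ, hdvd⟩ := WfDvdMonoid.exists_irreducible_factor hu (right_ne_zero_of_mul ha)
  obtain ⟨s, hs, hd⟩ := h π hπ.prime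
  rw [mul_left_comm] at hd
  exact hs (hdvd.trans (hab.dvd_of_dvd_mul_right
    ((mul_dvd_mul_iff_left (left_ne_zero_of_mul ha)).1 hd)))

/-- Prime avoidance: the ideal `(a, b)` lies in none of the finitely many principal primes `(π)`
with `π ∣ H`, hence not in their union. -/
theorem IsRelPrime.exists_isRelPrime_add {a b H : A} (hab : IsRelPrime a b) (hH : H ≠ 0) :
    ∃ x y, IsRelPrime (x * a + y * b) H := by
  classical
  let : StrongNormalizationMonoid A := UniqueFactorizationMonoid.strongNormalizationMonoid
  let s := (UniqueFactorizationMonoid.normalizedFactors H).toFinset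
  have hs : ∀ π ∈ s, Prime π := fun π hπ =>
    UniqueFactorizationMonoid.prime_of_normalized_factor π (Multiset.mem_toFinset.1 hπ)
  have hnot : ¬ ((Ideal.span {a, b} : Ideal A) : Set A) ⊆
      ⋃ i ∈ (s : Set A), ((Ideal.span {i} : Ideal A) : Set A) := by
    rw [Ideal.subset_union_prime (f := fun i => Ideal.span {i}) 0 0
      (fun i hi _ _ => (Ideal.span_singleton_prime (hs i hi).ne_zero).2 (hs i hi))]
    rintro ⟨i, hi, hle⟩
    refine (hs i hi).not_isUnit (hab ?_ ?_)
    · exact Ideal.mem_span_singleton.1 (hle (Ideal.subset_span (by simp)))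
    · exact Ideal.mem_span_singleton.1 (hle (Ideal.subset_span (by simp)))
  obtain ⟨c, hc, hc'⟩ := Set.not_subset.1 hnot
  obtain ⟨x, y, rfl⟩ := Ideal.mem_span_pair.1 hc
  refine ⟨x, y, isRelPrime_comm.1 ?_⟩
  rw [UniqueFactorizationMonoid.isRelPrime_iff_no_prime_factors hH]
  intro d hd hdb hdp
  obtain ⟨q, hq, hdq⟩ := UniqueFactorizationMonoid.exists_mem_normalizedFactors_of_dvd hH
    hdp.irreducible hd
  refine hc' (Set.mem_biUnion (Finset.mem_coe.2 (Multiset.mem_toFinset.2 hq)) ?_)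
  exact Ideal.mem_span_singleton.2 (hdq.symm.dvd.trans hdb)

/-- The elements which are relatively prime to `H`. -/
def relPrimeSubmonoid (H : A) : Submonoid A where
  carrier := {s | IsRelPrime s H}
  mul_mem' := fun h h' => IsRelPrime.mul_left h h'
  one_mem' := isRelPrime_one_left

theorem relPrimeSubmonoid_le {H : A} (hu : ¬ IsUnit H) :
    relPrimeSubmonoid H ≤ nonZeroDivisors A := by
  intro s hs
  refine mem_nonZeroDivisors_of_ne_zero ?_
  rintro rfl
  exact hu (isRelPrime_zero_left.1 hs)

/-- The ring is noetherian, so two generators at a time suffice. Write the numerators as `d a'` and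
`d b'` with `a'`, `b'` relatively prime; some combination of `a'` and `b'` is prime to `H`, hence a
unit in `R`, and so `d` generates. -/
theorem isPrincipalIdealRing_of_relPrimeSubmonoid [IsNoetherianRing A] {H : A} (hH : H ≠ 0)
    (hu : ¬ IsUnit H) (R : Type*) [CommRing R] [Algebra A R]
    [IsLocalization (relPrimeSubmonoid H) R] : IsPrincipalIdealRing R := by
  have : IsDomain R := IsLocalization.isDomain_of_le_nonZeroDivisors R (relPrimeSubmonoid_le hu)
  have : IsNoetherianRing R := IsLocalization.isNoetherianRing (relPrimeSubmonoid H) R inferInstance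
  have : IsBezout R := by
    rw [IsBezout.iff_span_pair_isPrincipal]
    intro x y
    obtain ⟨⟨a, s⟩, hx⟩ := IsLocalization.surj (relPrimeSubmonoid H) x
    obtain ⟨⟨b, t⟩, hy⟩ := IsLocalization.surj (relPrimeSubmonoid H) y
    by_cases hb : b = 0
    · have hy0 : y = 0 := by
        simp only [hb, map_zero] at hy
        exact (IsLocalization.map_units R t).mul_left_eq_zero.1 hy
      exact ⟨x, by simp [hy0, Set.pair_comm x 0, Ideal.span]⟩
    obtain ⟨a', b', d, hab, rfl, rfl⟩ := UniqueFactorizationMonoid.exists_reduced_factors' a b hb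
    obtain ⟨u, v, huv⟩ := hab.exists_isRelPrime_add hH
    have hunit := IsLocalization.map_units R (⟨_, huv⟩ : relPrimeSubmonoid H)
    have hs := IsLocalization.map_units R s
    have ht := IsLocalization.map_units R t
    refine ⟨algebraMap A R d, le_antisymm ?_ ?_⟩
    · refine Ideal.span_le.2 ?_
      rintro z (rfl | rfl)
      · refine Ideal.mem_span_singleton.2 ((hs.dvd_mul_right).1 ⟨algebraMap A R a', ?_⟩)
        simpa using hx
      · refine Ideal.mem_span_singleton.2 ((ht.dvd_mul_right).1 ⟨algebraMap A R b', ?_⟩)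
        simpa using hy
    · refine (Ideal.span_singleton_le_iff_mem _).2 ((Ideal.mul_unit_mem_iff_mem _ hunit).1 ?_)
      refine Ideal.mem_span_pair.2 ⟨algebraMap A R (u * s), algebraMap A R (v * t), ?_⟩
      simp only [map_add, map_mul] at hx hy ⊢
      linear_combination (algebraMap A R u) * hx + (algebraMap A R v) * hy
  exact ((IsBezout.TFAE (R := R)).out 0 1).1 ‹_›

/-- Clearing denominators gives `a * b = H * (s * t)`. Splitting `a` accordingly leaves a divisor
`c` of `H` times a divisor of `s * t`, and the latter becomes a unit. -/
theorem exists_dvd_associated_of_relPrimeSubmonoid {H : A} {R : Type*} [CommRing R] [Algebra A R]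
    (hu : ¬ IsUnit H) [IsLocalization (relPrimeSubmonoid H) R] {d : R} (hd : d ∣ algebraMap A R H) :
    ∃ c, c ∣ H ∧ Associated (algebraMap A R c) d := by
  obtain ⟨d', hd'⟩ := hd
  obtain ⟨⟨a, s⟩, ha⟩ := IsLocalization.surj (relPrimeSubmonoid H) d
  obtain ⟨⟨b, t⟩, hb⟩ := IsLocalization.surj (relPrimeSubmonoid H) d'
  simp only at ha hb
  have : a * b = H * (s * t) := by
    refine IsLocalization.injective R (relPrimeSubmonoid_le hu) ?_
    simp only [map_mul, hd', ← ha, ← hb]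
    ring
  obtain ⟨c, u, hc, hu', rfl⟩ := exists_dvd_and_dvd_of_dvd_mul (Dvd.intro _ this)
  have hu'' : u ∈ relPrimeSubmonoid H := fun x hx hx' => (s * t).2 (hx.trans hu') hx'
  refine ⟨c, hc, ?_⟩
  have h1 : Associated d (d * algebraMap A R s) :=
    associated_mul_unit_right _ _ (IsLocalization.map_units R s)
  rw [ha, map_mul] at h1
  exact (h1.trans (associated_mul_unit_left _ _ (IsLocalization.map_units R
    (⟨u, hu''⟩ : relPrimeSubmonoid H)))).symm

end UFD

/-! ### Structure of torsion modules up to pseudo-isomorphism -/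

section StructureTheorem

variable {A : Type*} [CommRing A]

theorem IsPseudoNull.exists_not_dvd {M : Type*} [AddCommGroup M] [Module A M]
    (h : IsPseudoNull A M) {π : A} (hπ : Prime π) : ∃ s, ¬ π ∣ s ∧ ∀ x : M, s • x = 0 := by
  obtain ⟨a, b, hab, ha, hb⟩ := h
  by_cases hd : π ∣ a
  · exact ⟨b, fun hd' => hπ.not_isUnit (hab hd hd'), hb⟩
  · exact ⟨a, hd, ha⟩

/-- Of two relatively prime annihilators, `π` divides at most one. A pseudo-isomorphism is therefore
invertible near every height-one prime, and this is the only form in which it is used for comparing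
determinants. -/
theorem IsPseudoIsomorphism.exists_inverse_up_to_smul {M N : Type*} [AddCommGroup M] [Module A M]
    [AddCommGroup N] [Module A N] {φ : M →ₗ[A] N} (h : IsPseudoIsomorphism φ) {π : A}
    (hπ : Prime π) : ∃ (ψ : N →ₗ[A] M) (s : A), ¬ π ∣ s ∧ (∀ x, ψ (φ x) = s • x) ∧
      ∀ y, φ (ψ y) = s • y := by
  obtain ⟨s, hs, hs'⟩ := h.1.exists_not_dvd hπ
  obtain ⟨t, ht, ht'⟩ := h.2.exists_not_dvd hπ
  have hk : ∀ x ∈ LinearMap.ker φ, (s * t) • x = 0 := fun x hx => by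
    rw [mul_comm, mul_smul]
    have := congrArg Subtype.val (hs' ⟨x, hx⟩)
    simp only [Submodule.coe_smul, ZeroMemClass.coe_zero] at this
    rw [this, smul_zero]
  have hc : ∀ y, (s * t) • y ∈ LinearMap.range φ := fun y => by
    rw [mul_smul]
    refine Submodule.smul_mem _ _ ?_
    have := ht' (Submodule.Quotient.mk y)
    rwa [← Submodule.Quotient.mk_smul, Submodule.Quotient.mk_eq_zero] at this
  obtain ⟨ψ, h1, h2⟩ := φ.exists_inverse_up_to_smul (s * t) hk hc
  refine ⟨ψ, s * t * (s * t), fun hd => ?_, h1, h2⟩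
  rcases hπ.dvd_or_dvd hd with hd | hd <;> rcases hπ.dvd_or_dvd hd with hd | hd <;> contradiction

/-- A homomorphism with an inverse up to multiplication by `s` is a pseudo-isomorphism if both
modules are annihilated by an element relatively prime to `s`. -/
theorem isPseudoIsomorphism_of_inverse_up_to_smul {M N : Type*} [AddCommGroup M] [Module A M]
    [AddCommGroup N] [Module A N] (φ : M →ₗ[A] N) (ψ : N →ₗ[A] M) {s H : A} (hs : IsRelPrime s H)
    (h1 : ∀ x, ψ (φ x) = s • x) (h2 : ∀ y, φ (ψ y) = s • y) (hM : ∀ x : M, H • x = 0)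
    (hN : ∀ y : N, H • y = 0) : IsPseudoIsomorphism φ := by
  refine ⟨⟨s, H, hs, fun x => Subtype.ext ?_, fun x => Subtype.ext ?_⟩, ⟨s, H, hs, ?_, ?_⟩⟩
  · have := h1 x
    rw [x.2, map_zero] at this
    exact this.symm
  · exact hM _
  · intro y
    obtain ⟨y, rfl⟩ := Submodule.Quotient.mk_surjective _ y
    rw [← Submodule.Quotient.mk_smul, Submodule.Quotient.mk_eq_zero]
    exact ⟨ψ y, h2 y⟩
  · intro y
    obtain ⟨y, rfl⟩ := Submodule.Quotient.mk_surjective _ y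
    rw [← Submodule.Quotient.mk_smul, hN, Submodule.Quotient.mk_zero]

theorem Submodule.smul_mkQ_span_singleton_eq_zero {a b : A} (h : b ∣ a) (x : A ⧸ Ideal.span {b}) :
    a • x = 0 := by
  obtain ⟨x, rfl⟩ := Submodule.Quotient.mk_surjective _ x
  rw [← Submodule.Quotient.mk_smul, Submodule.Quotient.mk_eq_zero, smul_eq_mul]
  exact Ideal.mem_span_singleton.2 (h.mul_right x)

/-- Multiplication by `x`, as a map `A ⧸ (a) → A ⧸ (b)`, where `b` divides `x * a`. -/
def quotientSpanMul (x : A) {a b : A} (h : b ∣ x * a) :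
    (A ⧸ Ideal.span {a}) →ₗ[A] (A ⧸ Ideal.span {b}) :=
  Submodule.mapQ _ _ (LinearMap.mulLeft A x) ((Ideal.span_singleton_le_iff_mem _).2
    (Ideal.mem_span_singleton.2 h))

theorem quotientSpanMul_comp (x y : A) {a b c : A} (h : b ∣ x * a) (h' : c ∣ y * b)
    (h'' : c ∣ (y * x) * a) (u : A ⧸ Ideal.span {a}) :
    quotientSpanMul y h' (quotientSpanMul x h u) = quotientSpanMul (y * x) h'' u := by
  obtain ⟨u, rfl⟩ := Submodule.Quotient.mk_surjective _ u
  simp only [quotientSpanMul, Submodule.mapQ_apply, LinearMap.mulLeft_apply, mul_assoc]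

theorem quotientSpanMul_self (x : A) {a : A} (h : a ∣ x * a) (u : A ⧸ Ideal.span {a}) :
    quotientSpanMul x h u = x • u := by
  obtain ⟨u, rfl⟩ := Submodule.Quotient.mk_surjective _ u
  rfl

theorem quotientSpanMul_eq_zero (x : A) {a b : A} (h : b ∣ x * a) (hx : b ∣ x)
    (u : A ⧸ Ideal.span {a}) : quotientSpanMul x h u = 0 := by
  obtain ⟨u, rfl⟩ := Submodule.Quotient.mk_surjective _ u
  simp only [quotientSpanMul, Submodule.mapQ_apply, LinearMap.mulLeft_apply,
    Submodule.Quotient.mk_eq_zero]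
  exact Ideal.mem_span_singleton.2 (hx.mul_right u)

/-- A Chinese remainder theorem up to the factor `x + y`. The backward map is `(v, w) ↦ y v + x w`;
it is well defined because `b i ∣ y` and `a i ∣ x`. The composites are multiplication by `x + y`
because `x` kills `A/(a i)` and `y` kills `A/(b i)`. -/
theorem exists_inverse_up_to_smul_pi_prod {ι : Type*} [Fintype ι] (a b : ι → A) {x y : A}
    (hx : ∏ i, a i ∣ x) (hy : ∏ i, b i ∣ y) :
    ∃ (φ : (∀ i, A ⧸ Ideal.span {a i * b i}) →ₗ[A]
        (∀ i, A ⧸ Ideal.span {a i}) × (∀ i, A ⧸ Ideal.span {b i}))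
      (ψ : (∀ i, A ⧸ Ideal.span {a i}) × (∀ i, A ⧸ Ideal.span {b i}) →ₗ[A]
        (∀ i, A ⧸ Ideal.span {a i * b i})),
      (∀ u, ψ (φ u) = (x + y) • u) ∧ ∀ v, φ (ψ v) = (x + y) • v := by
  have hx' : ∀ i, a i ∣ x := fun i => (Finset.dvd_prod_of_mem a (Finset.mem_univ i)).trans hx
  have hy' : ∀ i, b i ∣ y := fun i => (Finset.dvd_prod_of_mem b (Finset.mem_univ i)).trans hy
  have d1 : ∀ i, a i ∣ 1 * (a i * b i) := fun i => ⟨b i, by ring⟩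
  have d2 : ∀ i, b i ∣ 1 * (a i * b i) := fun i => ⟨a i, by ring⟩
  have d3 : ∀ i, a i * b i ∣ y * a i := fun i => by
    rw [mul_comm]; exact mul_dvd_mul_right (hy' i) _
  have d4 : ∀ i, a i * b i ∣ x * b i := fun i => mul_dvd_mul_right (hx' i) _
  refine ⟨LinearMap.prod
      (LinearMap.pi fun i => quotientSpanMul 1 (d1 i) ∘ₗ LinearMap.proj i)
      (LinearMap.pi fun i => quotientSpanMul 1 (d2 i) ∘ₗ LinearMap.proj i),
    LinearMap.coprod
      (LinearMap.pi fun i => quotientSpanMul y (d3 i) ∘ₗ LinearMap.proj i)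
      (LinearMap.pi fun i => quotientSpanMul x (d4 i) ∘ₗ LinearMap.proj i), ?_, ?_⟩
  · intro u
    funext i
    simp only [LinearMap.prod_apply, Function.prod_apply, LinearMap.coprod_apply, LinearMap.pi_apply, Pi.add_apply,
      LinearMap.comp_apply, LinearMap.proj_apply, Pi.smul_apply]
    rw [quotientSpanMul_comp _ _ _ _ ⟨y, by ring⟩, quotientSpanMul_comp _ _ _ _ ⟨x, by ring⟩,
      quotientSpanMul_self, quotientSpanMul_self, ← add_smul, mul_one, mul_one, add_comm]
  · rintro ⟨v, w⟩
    refine Prod.ext (funext fun i => ?_) (funext fun i => ?_)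
    · change quotientSpanMul 1 (d1 i) (quotientSpanMul y (d3 i) (v i) +
        quotientSpanMul x (d4 i) (w i)) = (x + y) • v i
      rw [map_add, quotientSpanMul_comp _ _ _ _ (dvd_mul_left _ _),
        quotientSpanMul_comp _ _ _ _ (((hx' i).mul_left 1).mul_right _), quotientSpanMul_self,
        quotientSpanMul_eq_zero _ _ ((hx' i).mul_left 1), add_zero, one_mul, add_smul,
        Submodule.smul_mkQ_span_singleton_eq_zero (hx' i), zero_add]
    · change quotientSpanMul 1 (d2 i) (quotientSpanMul y (d3 i) (v i) +
        quotientSpanMul x (d4 i) (w i)) = (x + y) • w i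
      rw [map_add, quotientSpanMul_comp _ _ _ _ (((hy' i).mul_left 1).mul_right _),
        quotientSpanMul_comp _ _ _ _ (dvd_mul_left _ _),
        quotientSpanMul_self, quotientSpanMul_eq_zero _ _ ((hy' i).mul_left 1), zero_add, one_mul,
        add_smul, Submodule.smul_mkQ_span_singleton_eq_zero (hy' i), add_zero]

variable [IsDomain A] [UniqueFactorizationMonoid A] [IsNoetherianRing A]

/-- Inverting the elements prime to `H` yields a principal ideal domain, where the classical
structure theorem applies. Its elementary divisors divide `H`, so they come from `A`, and the
isomorphism descends by finite presentation. -/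
theorem exists_inverse_up_to_smul_pi_quotient {M : Type*} [AddCommGroup M] [Module A M]
    [Module.Finite A M] {H : A} (hH : H ≠ 0) (hu : ¬ IsUnit H) (hM : ∀ x : M, H • x = 0) :
    ∃ (n : ℕ) (c : Fin n → A), (∀ i, c i ∣ H) ∧
      ∃ (φ : M →ₗ[A] ∀ i, A ⧸ Ideal.span {c i}) (ψ : (∀ i, A ⧸ Ideal.span {c i}) →ₗ[A] M),
      ∃ s, IsRelPrime s H ∧ (∀ x, ψ (φ x) = s • x) ∧ ∀ y, φ (ψ y) = s • y := by
  classical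
  let S := relPrimeSubmonoid H
  let R := Localization S
  have : IsDomain R := IsLocalization.isDomain_of_le_nonZeroDivisors R (relPrimeSubmonoid_le hu)
  have : IsPrincipalIdealRing R := isPrincipalIdealRing_of_relPrimeSubmonoid hH hu R
  have hHR : algebraMap A R H ≠ 0 := fun h0 => hH
    (IsLocalization.injective R (relPrimeSubmonoid_le hu) (h0.trans (map_zero _).symm))
  have hann : ∀ x : LocalizedModule S M, algebraMap A R H • x = 0 := by
    intro x
    induction x using LocalizedModule.induction_on with
    | h m s => rw [algebraMap_smul, LocalizedModule.smul'_mk, hM, LocalizedModule.zero_mk]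
  have htors : Module.IsTorsion R (LocalizedModule S M) := fun {x} =>
    ⟨⟨algebraMap A R H, mem_nonZeroDivisors_of_ne_zero hHR⟩, hann x⟩
  obtain ⟨ι, _, π, -, e, ⟨l⟩⟩ := Module.equiv_directSum_of_isTorsion htors
  have hd : ∀ i, π i ^ e i ∣ algebraMap A R H := by
    intro i
    -- Since `H` kills the class of `1` in the `i`-th summand, it lies in the ideal of that summand.
    let z : R ⧸ Submodule.span R {π i ^ e i} := Submodule.Quotient.mk 1
    have h1 : algebraMap A R H • DirectSum.of (fun i => R ⧸ Submodule.span R {π i ^ e i}) i z = 0 := by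
      rw [← l.apply_symm_apply (algebraMap A R H • _), map_smul, hann, map_zero]
    have h2 := DFunLike.congr_fun h1 i
    rw [DirectSum.smul_apply, DirectSum.of_eq_same] at h2
    rw [← Submodule.Quotient.mk_smul, DirectSum.zero_apply, Submodule.Quotient.mk_eq_zero] at h2
    simpa using Ideal.mem_span_singleton.1 h2
  choose c hc hc' using fun i => exists_dvd_associated_of_relPrimeSubmonoid (R := R) hu (hd i)
  let σ := Fintype.equivFin ι
  have hspan : ∀ i, Submodule.span R {π i ^ e i} =
      (Ideal.span {c i}).localized' R S (Algebra.linearMap A R) := by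
    intro i
    rw [Ideal.span, Submodule.localized'_span, Set.image_singleton, Algebra.linearMap_apply]
    exact (Ideal.span_singleton_eq_span_singleton.2 (hc' i)).symm
  let l1 := l ≪≫ₗ DirectSum.linearEquivFunOnFintype R ι _ ≪≫ₗ
    LinearEquiv.piCongrRight (fun i => Submodule.quotEquivOfEq _ _ (hspan i)) ≪≫ₗ
    LinearEquiv.piCongrLeft' R _ σ
  let g : (∀ i : Fin (Fintype.card ι), A ⧸ Ideal.span {c (σ.symm i)}) →ₗ[A] _ :=
    LinearMap.pi fun i =>
    (Submodule.toLocalizedQuotient' R S (Algebra.linearMap A R) (Ideal.span {c (σ.symm i)})) ∘ₗ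
      LinearMap.proj i
  have : IsLocalizedModule S g := IsLocalizedModule.pi S _
  have := Module.finitePresentation_of_finite A M
  have := Module.finitePresentation_of_finite A
    (∀ i : Fin (Fintype.card ι), A ⧸ Ideal.span {c (σ.symm i)})
  obtain ⟨φ, ψ, s, hs, h1, h2⟩ := Module.FinitePresentation.exists_inverse_up_to_smul S
    (LocalizedModule.mkLinearMap S M) g (l1.restrictScalars A)
  exact ⟨_, _, fun i => hc (σ.symm i), φ, ψ, s, hs, h1, h2⟩

/-- Structure theorem for finitely generated torsion modules over a noetherian factorial domain, up
to pseudo-isomorphism, with the powers of a fixed prime element separated off. -/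
theorem exists_isPseudoIsomorphism_elementary {p : A} (hp : Prime p) {M : Type*} [AddCommGroup M]
    [Module A M] [Module.Finite A M] {H : A} (hH : H ≠ 0) (hM : ∀ x : M, H • x = 0) :
    ∃ (n : ℕ) (e : Fin n → ℕ) (g : Fin n → A), (∀ j, IsRelPrime (g j) p) ∧
      ∃ φ : M →ₗ[A] (∀ i, A ⧸ Ideal.span {p ^ e i}) × (∀ j, A ⧸ Ideal.span {g j}),
        IsPseudoIsomorphism φ := by
  -- The annihilator is replaced by `p * H` because `H` itself may be a unit.
  have hH' : p * H ≠ 0 := mul_ne_zero hp.ne_zero hH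
  have hM' : ∀ x : M, (p * H) • x = 0 := fun x => by rw [mul_smul, hM, smul_zero]
  obtain ⟨n, c, hc, φ, ψ, s, hs, h1, h2⟩ := exists_inverse_up_to_smul_pi_quotient hH'
    (fun hu => hp.not_isUnit (isUnit_of_mul_isUnit_left hu)) hM'
  have hc0 : ∀ i, c i ≠ 0 := fun i h0 => hH' (zero_dvd_iff.1 (h0 ▸ hc i))
  have hfac : ∀ i, ∃ (k : ℕ) (b : A), c i = p ^ k * b ∧ ¬ p ∣ b := fun i =>
    ⟨_, (FiniteMultiplicity.of_prime_left hp (hc0 i)).exists_eq_pow_mul_and_not_dvd⟩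
  choose e g hg hcg using hfac
  have hrel : ∀ i, IsRelPrime (g i) p := fun i =>
    isRelPrime_comm.1 ((hp.irreducible.isRelPrime_iff_not_dvd).2 (hcg i))
  obtain rfl : c = fun i => p ^ e i * g i := funext hg
  have hprod : IsRelPrime (∏ i, p ^ e i) (∏ i, g i) :=
    IsRelPrime.prod_left fun i _ => IsRelPrime.prod_right fun j _ =>
      IsRelPrime.pow_left (isRelPrime_comm.1 (hrel j))
  -- The coefficients are chosen so that the scalar in the Chinese remainder step is prime to the
  -- annihilator; splitting off the powers of `p` is then a pseudo-isomorphism.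
  obtain ⟨x, y, hxy⟩ := hprod.exists_isRelPrime_add hH'
  obtain ⟨φ', ψ', h1', h2'⟩ := exists_inverse_up_to_smul_pi_prod (fun i => p ^ e i) g
    (dvd_mul_left _ x) (dvd_mul_left _ y)
  refine ⟨n, e, g, hrel, φ' ∘ₗ φ, isPseudoIsomorphism_of_inverse_up_to_smul _ (ψ ∘ₗ ψ')
    (hs.mul_left hxy) (fun u => ?_) (fun u => ?_) hM' (fun u => ?_)⟩
  · simp only [LinearMap.comp_apply]
    rw [h1', map_smul, h1, smul_smul, mul_comm]
  · simp only [LinearMap.comp_apply]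
    rw [h2, map_smul, h2', smul_smul]
  · refine Prod.ext (funext fun i => ?_) (funext fun i => ?_)
    · exact Submodule.smul_mkQ_span_singleton_eq_zero ((dvd_mul_right _ _).trans (hc i)) _
    · exact Submodule.smul_mkQ_span_singleton_eq_zero ((dvd_mul_left _ _).trans (hc i)) _

end StructureTheorem

/-! ### Presentation matrices and pseudo-isomorphisms -/

section Cokernel

variable {A : Type*} [CommRing A]

theorem Matrix.det_smul_coker {n : Type*} [Fintype n] [DecidableEq n] (P : Matrix n n A)
    (x : (n → A) ⧸ LinearMap.range P.mulVecLin) : P.det • x = 0 := by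
  obtain ⟨x, rfl⟩ := Submodule.Quotient.mk_surjective _ x
  rw [← Submodule.Quotient.mk_smul, Submodule.Quotient.mk_eq_zero]
  exact ⟨P.adjugate.mulVec x, by simp [Matrix.mulVec_mulVec, Matrix.mul_adjugate, Matrix.smul_mulVec]⟩

/-- A product of cyclic modules is the cokernel of a diagonal matrix. -/
theorem Matrix.nonempty_coker_diagonal_equiv {n : Type*} [Fintype n] [DecidableEq n] (d : n → A) :
    Nonempty (((n → A) ⧸ LinearMap.range (Matrix.diagonal d).mulVecLin) ≃ₗ[A]
      ∀ i, A ⧸ Ideal.span {d i}) := by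
  let f : (n → A) →ₗ[A] ∀ i, A ⧸ Ideal.span {d i} :=
    LinearMap.pi fun i => (Ideal.span {d i}).mkQ ∘ₗ LinearMap.proj i
  have hf : Function.Surjective f := fun y => by
    choose x hx using fun i => Submodule.mkQ_surjective _ (y i)
    exact ⟨x, funext hx⟩
  have hk : LinearMap.ker f = LinearMap.range (Matrix.diagonal d).mulVecLin := by
    ext x
    constructor
    · intro hx
      have : ∀ i, ∃ c, x i = d i * c := fun i => by
        have := congrFun (LinearMap.mem_ker.1 hx) i
        exact Ideal.mem_span_singleton.1 ((Submodule.Quotient.mk_eq_zero _).1 this)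
      choose c hc using this
      exact ⟨c, funext fun i => by simp [Matrix.mulVec_diagonal, hc]⟩
    · rintro ⟨c, rfl⟩
      refine LinearMap.mem_ker.2 (funext fun i => ?_)
      refine (Submodule.Quotient.mk_eq_zero _).2 (Ideal.mem_span_singleton.2 ?_)
      simp [Matrix.mulVec_diagonal]
  exact ⟨(Submodule.quotEquivOfEq _ _ hk.symm) ≪≫ₗ f.quotKerEquivOfSurjective hf⟩

/-- The determinant of a square presentation matrix of a module is determined, up to associates, by
the module up to pseudo-isomorphism. -/
theorem Matrix.associated_det_of_isPseudoIsomorphism [IsDomain A] [UniqueFactorizationMonoid A]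
    {m n : Type*} [Fintype m] [Fintype n] [DecidableEq m] [DecidableEq n] {P : Matrix n n A}
    {Q : Matrix m m A} (hP : P.det ≠ 0) (hQ : Q.det ≠ 0)
    (φ : ((n → A) ⧸ LinearMap.range P.mulVecLin) →ₗ[A] ((m → A) ⧸ LinearMap.range Q.mulVecLin))
    (hφ : IsPseudoIsomorphism φ) : Associated P.det Q.det := by
  refine associated_of_dvd_dvd (dvd_of_forall_prime_dvd_mul hP hQ fun π hπ => ?_)
    (dvd_of_forall_prime_dvd_mul hQ hP fun π hπ => ?_)
  · obtain ⟨ψ, s, hs, h1, -⟩ := hφ.exists_inverse_up_to_smul hπ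
    exact ⟨_, fun hd => hs (hπ.dvd_of_dvd_pow hd), Matrix.det_dvd_pow_mul_det s φ ψ h1⟩
  · obtain ⟨ψ, s, hs, -, h2⟩ := hφ.exists_inverse_up_to_smul hπ
    exact ⟨_, fun hd => hs (hπ.dvd_of_dvd_pow hd), Matrix.det_dvd_pow_mul_det s ψ φ h2⟩

theorem IsPseudoIsomorphism.of_equiv {M M' N N' : Type*} [AddCommGroup M] [Module A M]
    [AddCommGroup N] [Module A N] [AddCommGroup M'] [Module A M'] [AddCommGroup N'] [Module A N']
    {φ : M →ₗ[A] N} (h : IsPseudoIsomorphism φ) (e : M' ≃ₗ[A] M) (e' : N ≃ₗ[A] N') :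
    IsPseudoIsomorphism (e'.toLinearMap ∘ₗ φ ∘ₗ e.toLinearMap) := by
  obtain ⟨⟨a, b, hab, ha, hb⟩, c, d, hcd, hc, hd⟩ := h
  have hk : ∀ s : A, (∀ x : LinearMap.ker φ, s • x = 0) →
      ∀ x : LinearMap.ker (e'.toLinearMap ∘ₗ φ ∘ₗ e.toLinearMap), s • x = 0 := by
    intro s hs x
    have hx : φ (e x) = 0 := by
      have := x.2
      simpa using this
    have := congrArg Subtype.val (hs ⟨e x, hx⟩)
    simp only [Submodule.coe_smul, ZeroMemClass.coe_zero] at this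
    refine Subtype.ext (e.injective ?_)
    simp [this]
  have hr : ∀ s : A, (∀ y : N ⧸ LinearMap.range φ, s • y = 0) →
      ∀ y : N' ⧸ LinearMap.range (e'.toLinearMap ∘ₗ φ ∘ₗ e.toLinearMap), s • y = 0 := by
    intro s hs y
    obtain ⟨y, rfl⟩ := Submodule.Quotient.mk_surjective _ y
    have := hs (Submodule.Quotient.mk (e'.symm y))
    rw [← Submodule.Quotient.mk_smul, Submodule.Quotient.mk_eq_zero] at this ⊢
    obtain ⟨x, hx⟩ := this
    exact ⟨e.symm x, by simp [hx]⟩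
  exact ⟨⟨a, b, hab, hk a ha, hk b hb⟩, c, d, hcd, hr c hc, hr d hd⟩

end Cokernel

/-! ### Characteristic power series and determinants -/

section CharPowerSeries

variable {p : ℕ} [Fact p.Prime]

theorem PowerSeries.natCast_pow_dvd_iff {k : ℕ} {f : PowerSeries ℤ_[p]} :
    (p : PowerSeries ℤ_[p]) ^ k ∣ f ↔ ∀ n, (p : ℤ_[p]) ^ k ∣ PowerSeries.coeff n f := by
  have hp : (p : PowerSeries ℤ_[p]) ^ k = PowerSeries.C ((p : ℤ_[p]) ^ k) := by simp
  constructor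
  · rintro ⟨g, rfl⟩ n
    exact ⟨_, by rw [hp, PowerSeries.coeff_C_mul]⟩
  · intro h
    choose c hc using h
    refine ⟨PowerSeries.mk c, ?_⟩
    ext n
    rw [hc, hp, PowerSeries.coeff_C_mul, PowerSeries.coeff_mk]

theorem PowerSeries.natCast_dvd_iff_map_eq_zero {f : PowerSeries ℤ_[p]} :
    (p : PowerSeries ℤ_[p]) ∣ f ↔ f.map (IsLocalRing.residue ℤ_[p]) = 0 := by
  have := PowerSeries.natCast_pow_dvd_iff (p := p) (k := 1) (f := f)
  rw [pow_one] at this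
  rw [this, PowerSeries.ext_iff]
  refine forall_congr' fun n => ?_
  rw [PowerSeries.coeff_map, map_zero, IsLocalRing.residue_eq_zero_iff,
    PadicInt.maximalIdeal_eq_span_p, Ideal.mem_span_singleton, pow_one]

theorem PadicInt.prime_natCast_powerSeries : Prime (p : PowerSeries ℤ_[p]) := by
  have h0 : (p : PowerSeries ℤ_[p]) ≠ 0 := fun h => by
    have := congrArg (PowerSeries.constantCoeff (R := ℤ_[p])) h
    rw [map_natCast, map_zero, Nat.cast_eq_zero] at this
    exact (Fact.out : p.Prime).ne_zero this
  rw [← Ideal.span_singleton_prime h0]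
  have : Ideal.span {(p : PowerSeries ℤ_[p])} =
      RingHom.ker (PowerSeries.map (IsLocalRing.residue ℤ_[p])) := by
    ext f
    rw [Ideal.mem_span_singleton, RingHom.mem_ker, PowerSeries.natCast_dvd_iff_map_eq_zero]
  rw [this]
  exact RingHom.ker_isPrime _

variable {n : Type*} [Fintype n] [DecidableEq n] {P : Matrix n n (PowerSeries ℤ_[p])}
  {M : Type*} [AddCommGroup M] [Module (PowerSeries ℤ_[p]) M]

/-- An elementary module is the cokernel of a diagonal matrix whose determinant is the prescribed
power series, so the invariance of determinants under pseudo-isomorphism applies. -/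
theorem IsCharPowerSeries.associated_det (hP : P.det ≠ 0)
    (l : M ≃ₗ[PowerSeries ℤ_[p]] ((n → PowerSeries ℤ_[p]) ⧸ LinearMap.range P.mulVecLin))
    {F : PowerSeries ℤ_[p]} (hF : IsCharPowerSeries p M F) : Associated F P.det := by
  obtain ⟨s, t, e, g, hg, ⟨φ, hφ⟩, rfl⟩ := hF
  have hp := PadicInt.prime_natCast_powerSeries (p := p)
  have hg0 : ∀ j, g j ≠ 0 := fun j h0 => hp.not_isUnit (isRelPrime_zero_left.1 (h0 ▸ hg j))
  obtain ⟨l1⟩ := Matrix.nonempty_coker_diagonal_equiv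
    (Sum.elim (fun i => (p : PowerSeries ℤ_[p]) ^ e i) g)
  let l2 : ElementaryModule p e g ≃ₗ[PowerSeries ℤ_[p]]
      ∀ i : Fin s ⊕ Fin t, PowerSeries ℤ_[p] ⧸ Ideal.span
        {Sum.elim (fun i => (p : PowerSeries ℤ_[p]) ^ e i) g i} :=
    (LinearEquiv.sumPiEquivProdPi (PowerSeries ℤ_[p]) (Fin s) (Fin t) (fun i => PowerSeries ℤ_[p] ⧸
      Ideal.span {Sum.elim (fun i => (p : PowerSeries ℤ_[p]) ^ e i) g i})).symm
  have hdet : (Matrix.diagonal (Sum.elim (fun i => (p : PowerSeries ℤ_[p]) ^ e i) g)).det =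
      (p : PowerSeries ℤ_[p]) ^ (∑ i, e i) * ∏ j, g j := by
    rw [Matrix.det_diagonal, Fintype.prod_sum_type, ← Finset.prod_pow_eq_pow_sum]
    simp
  rw [← hdet]
  refine (Matrix.associated_det_of_isPseudoIsomorphism hP ?_ _
    (hφ.of_equiv l.symm (l2 ≪≫ₗ l1.symm))).symm
  rw [hdet]
  exact mul_ne_zero (pow_ne_zero _ hp.ne_zero) (Finset.prod_ne_zero_iff.2 fun j _ => hg0 j)

theorem exists_isCharPowerSeries (hP : P.det ≠ 0)
    (l : M ≃ₗ[PowerSeries ℤ_[p]] ((n → PowerSeries ℤ_[p]) ⧸ LinearMap.range P.mulVecLin)) :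
    ∃ F, IsCharPowerSeries p M F := by
  obtain ⟨k, e, g, hg, φ, hφ⟩ := exists_isPseudoIsomorphism_elementary
    (PadicInt.prime_natCast_powerSeries (p := p)) hP (Matrix.det_smul_coker P)
  exact ⟨_, k, k, e, g, hg, ⟨_, hφ.of_equiv l (LinearEquiv.refl _ _)⟩, rfl⟩

/-- Every non-zero power series over `ℤ_p` is associated with `p ^ μ` times a distinguished
polynomial. -/
theorem PowerSeries.exists_associated_pow_mul_distinguished {F : PowerSeries ℤ_[p]} (hF : F ≠ 0) :
    ∃ (μ : ℕ) (G : ℤ_[p][X]), G.IsDistinguishedAt (IsLocalRing.maximalIdeal ℤ_[p]) ∧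
      Associated F ((p : PowerSeries ℤ_[p]) ^ μ * (G : PowerSeries ℤ_[p])) := by
  obtain ⟨f, hf, hpf⟩ := (FiniteMultiplicity.of_prime_left
    (PadicInt.prime_natCast_powerSeries (p := p)) hF).exists_eq_pow_mul_and_not_dvd
  have hmap : f.map (IsLocalRing.residue ℤ_[p]) ≠ 0 := fun h0 => hpf (PowerSeries.natCast_dvd_iff_map_eq_zero.2 h0)
  obtain ⟨G, h, hGh⟩ := PowerSeries.exists_isWeierstrassFactorization hmap
  refine ⟨multiplicity (p : PowerSeries ℤ_[p]) F, G, hGh.isDistinguishedAt, ?_⟩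
  nth_rw 1 [hf]
  rw [hGh.eq_mul]
  exact Associated.mul_left _ (associated_mul_unit_left _ _ hGh.isUnit)

theorem HasIwasawaInvariants.associated_det (hP : P.det ≠ 0)
    (l : M ≃ₗ[PowerSeries ℤ_[p]] ((n → PowerSeries ℤ_[p]) ⧸ LinearMap.range P.mulVecLin))
    {μ k : ℕ} (h : HasIwasawaInvariants p M μ k) : ∃ G : ℤ_[p][X],
      G.IsDistinguishedAt (IsLocalRing.maximalIdeal ℤ_[p]) ∧ G.natDegree = k ∧
      Associated P.det ((p : PowerSeries ℤ_[p]) ^ μ * (G : PowerSeries ℤ_[p])) := by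
  obtain ⟨F, hF, G, hG, hdeg, hass⟩ := h
  exact ⟨G, hG, hdeg, (hF.associated_det hP l).symm.trans hass⟩

/-- Existence of a characteristic power series and Weierstrass preparation exclude the dummy value
in the definition of the invariants. -/
theorem hasIwasawaInvariants_iwasawaInvariants (hP : P.det ≠ 0)
    (l : M ≃ₗ[PowerSeries ℤ_[p]] ((n → PowerSeries ℤ_[p]) ⧸ LinearMap.range P.mulVecLin)) :
    HasIwasawaInvariants p M (iwasawaInvariants p M).1 (iwasawaInvariants p M).2 := by
  have hex : ∃ q : ℕ × ℕ, HasIwasawaInvariants p M q.1 q.2 := by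
    obtain ⟨F, hF⟩ := exists_isCharPowerSeries hP l
    have hF0 : F ≠ 0 := fun h0 => hP ((hF.associated_det hP l).eq_zero_iff.1 h0)
    obtain ⟨μ, G, hG, hass⟩ := PowerSeries.exists_associated_pow_mul_distinguished hF0
    exact ⟨(μ, G.natDegree), F, hF, G, hG, rfl, hass⟩
  rw [iwasawaInvariants, dif_pos hex]
  exact hex.choose_spec

end CharPowerSeries

/-! ### Adic estimates in `Λ` and the power series `(1 + T) ^ a` -/

section Adic

/-- If `y ≡ 1` mod `I`, then `y^p - 1` is `y - 1` times `1 + y + ⋯ + y^(p-1)`, and the latter is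
congruent to `p`, hence to `0`. Each `p`-th power thus gains one factor from `I`. -/
theorem Ideal.exists_one_add_pow_sub_one_eq_mul {A : Type*} [CommRing A] (I : Ideal A) {p : ℕ}
    (hp : (p : A) ∈ I) {x : A} (hx : x ∈ I) (N : ℕ) :
    ∃ q ∈ I ^ N, (1 + x) ^ p ^ N - 1 = x * q := by
  induction N with
  | zero => exact ⟨1, by simp, by ring⟩
  | succ N ih =>
    obtain ⟨q, hq, h⟩ := ih
    refine ⟨q * ∑ i ∈ Finset.range p, ((1 + x) ^ p ^ N) ^ i, ?_, ?_⟩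
    · rw [pow_succ]
      refine Ideal.mul_mem_mul hq ?_
      rw [← Ideal.Quotient.eq_zero_iff_mem] at hp hx ⊢
      simpa [hx] using hp
    · rw [← mul_assoc, ← h, mul_comm, geom_sum_mul, ← pow_mul, pow_succ]

theorem Ideal.one_add_pow_sub_one_mem {A : Type*} [CommRing A] (I : Ideal A) {p : ℕ}
    (hp : (p : A) ∈ I) {x : A} (hx : x ∈ I) (N : ℕ) : (1 + x) ^ p ^ N - 1 ∈ I ^ (N + 1) := by
  obtain ⟨q, hq, h⟩ := I.exists_one_add_pow_sub_one_eq_mul hp hx N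
  rw [h, pow_succ']
  exact Ideal.mul_mem_mul hx hq

/-- Submodules of finitely generated modules over noetherian local rings are closed. -/
theorem Submodule.mem_of_forall_mem_sup_pow_smul {A M : Type*} [CommRing A] [IsNoetherianRing A]
    [IsLocalRing A] [AddCommGroup M] [Module A M] [Module.Finite A M] (L : Submodule A M) {x : M}
    (h : ∀ N, x ∈ L ⊔ IsLocalRing.maximalIdeal A ^ N • (⊤ : Submodule A M)) : x ∈ L := by
  have := Ideal.iInf_pow_smul_eq_bot_of_isLocalRing (M := M ⧸ L) (IsLocalRing.maximalIdeal A)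
    (Ideal.IsPrime.ne_top inferInstance)
  rw [← Submodule.Quotient.mk_eq_zero, ← Submodule.mem_bot A, ← this, Submodule.mem_iInf]
  intro N
  have h2 := Submodule.mem_map_of_mem (f := L.mkQ) (h N)
  rwa [Submodule.map_sup, Submodule.mkQ_map_self, bot_sup_eq, Submodule.map_smul'',
    Submodule.map_top, Submodule.range_mkQ] at h2

theorem Ideal.mem_of_forall_mem_sup_pow {A : Type*} [CommRing A] [IsNoetherianRing A]
    [IsLocalRing A] (J : Ideal A) {x : A} (h : ∀ N, x ∈ J ⊔ IsLocalRing.maximalIdeal A ^ N) :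
    x ∈ J := by
  refine Submodule.mem_of_forall_mem_sup_pow_smul J fun N => ?_
  rw [smul_eq_mul, Ideal.mul_top]
  exact h N

variable {p : ℕ} [Fact p.Prime]

local notation "Λ" => PowerSeries ℤ_[p]
local notation "𝔪" => IsLocalRing.maximalIdeal (PowerSeries ℤ_[p])

theorem mem_maximalIdeal_powerSeries_iff {f : Λ} :
    f ∈ 𝔪 ↔ (p : ℤ_[p]) ∣ PowerSeries.constantCoeff f := by
  rw [IsLocalRing.mem_maximalIdeal, mem_nonunits_iff, PowerSeries.isUnit_iff_constantCoeff,
    ← mem_nonunits_iff, ← IsLocalRing.mem_maximalIdeal, PadicInt.maximalIdeal_eq_span_p,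
    Ideal.mem_span_singleton]

theorem natCast_mem_maximalIdeal_powerSeries : (p : Λ) ∈ 𝔪 := by
  rw [mem_maximalIdeal_powerSeries_iff, map_natCast]

/-- The maximal ideal is `(p, T)`, and at most `i` of the `n` factors can contribute a `T` to the
coefficient of `T^i`. The subtraction is truncated, so nothing is claimed for `i ≥ n`. -/
theorem pow_dvd_coeff_of_mem_maximalIdeal_pow {n : ℕ} {f : Λ} (hf : f ∈ 𝔪 ^ n) (i : ℕ) :
    (p : ℤ_[p]) ^ (n - i) ∣ PowerSeries.coeff i f := by
  induction n generalizing f i with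
  | zero => simp
  | succ n ih =>
    rw [pow_succ] at hf
    refine Submodule.mul_induction_on hf (fun a ha b hb => ?_) (fun a b ha hb => ?_)
    · rw [PowerSeries.coeff_mul]
      refine Finset.dvd_sum fun ij hij => ?_
      replace hij := Finset.HasAntidiagonal.mem_antidiagonal.1 hij
      by_cases h0 : ij.2 = 0
      · rw [h0]
        have hb' := mem_maximalIdeal_powerSeries_iff.1 hb
        rw [← PowerSeries.coeff_zero_eq_constantCoeff_apply] at hb'
        refine (pow_dvd_pow _ (?_ : n + 1 - i ≤ (n - ij.1) + 1)).trans ?_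
        · omega
        · rw [pow_succ]
          exact mul_dvd_mul (ih ha _) hb'
      · refine ((pow_dvd_pow _ (?_ : n + 1 - i ≤ n - ij.1)).trans (ih ha _)).mul_right _
        omega
    · rw [map_add]
      exact dvd_add ha hb

theorem coe_omegaPoly (m : ℕ) : ((omegaPoly p m : ℤ_[p][X]) : Λ) = (1 + PowerSeries.X) ^ p ^ m - 1 := by
  simp [omegaPoly, add_comm]

theorem X_mem_maximalIdeal_powerSeries : (PowerSeries.X : Λ) ∈ 𝔪 := by
  rw [mem_maximalIdeal_powerSeries_iff, PowerSeries.constantCoeff_X]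
  exact dvd_zero _

theorem coe_omegaPoly_mem (m : ℕ) : ((omegaPoly p m : ℤ_[p][X]) : Λ) ∈ 𝔪 ^ (m + 1) := by
  rw [coe_omegaPoly]
  exact Ideal.one_add_pow_sub_one_mem _ natCast_mem_maximalIdeal_powerSeries
    X_mem_maximalIdeal_powerSeries m

theorem exists_coe_omegaPoly_add (m j : ℕ) : ∃ q ∈ 𝔪 ^ j,
    ((omegaPoly p (j + m) : ℤ_[p][X]) : Λ) = (omegaPoly p m : ℤ_[p][X]) * q := by
  obtain ⟨q, hq, h⟩ := Ideal.exists_one_add_pow_sub_one_eq_mul 𝔪 natCast_mem_maximalIdeal_powerSeries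
    (Ideal.pow_le_self m.succ_ne_zero (coe_omegaPoly_mem (p := p) m)) j
  refine ⟨q, hq, ?_⟩
  rw [← h, coe_omegaPoly, coe_omegaPoly, add_sub_cancel, ← pow_mul, pow_add, mul_comm]

open scoped PowerSeries.WithPiTopology

theorem summable_of_mem_maximalIdeal_pow {s : ℕ → Λ} (hs : ∀ j, s j ∈ 𝔪 ^ j) : Summable s := by
  rw [PowerSeries.WithPiTopology.summable_iff_summable_coeff]
  intro d
  refine NonarchimedeanAddGroup.summable_of_tendsto_cofinite_zero ?_
  rw [Nat.cofinite_eq_atTop, tendsto_zero_iff_norm_tendsto_zero]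
  have hlim : Filter.Tendsto (fun j : ℕ => ((p : ℝ)⁻¹) ^ (j - d)) Filter.atTop (nhds 0) :=
    (tendsto_pow_atTop_nhds_zero_of_lt_one (by positivity)
      (inv_lt_one_of_one_lt₀ (by exact_mod_cast (Fact.out : p.Prime).one_lt))).comp
      (Filter.tendsto_sub_atTop_nat d)
  refine squeeze_zero (fun _ => norm_nonneg _) (fun j => ?_) hlim
  have h := pow_dvd_coeff_of_mem_maximalIdeal_pow (hs j) d
  rw [← Ideal.mem_span_singleton, ← PadicInt.norm_le_pow_iff_mem_span_pow] at h
  simpa [zpow_neg] using h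

/-- Take the infinite sum of `ω_j k_j`. Its tail from `m` on is divisible by `ω_m`: the quotients
`ω_(j+m)/ω_m` tend to `0` adically, so the divided series converges as well. -/
theorem exists_omegaPoly_dvd_sub_sum (k : ℕ → Λ) : ∃ f : Λ, ∀ m,
    ((omegaPoly p m : ℤ_[p][X]) : Λ) ∣ f - ∑ j ∈ Finset.range m, ((omegaPoly p j : ℤ_[p][X]) : Λ) * k j := by
  have hs : Summable fun j => ((omegaPoly p j : ℤ_[p][X]) : Λ) * k j :=
    summable_of_mem_maximalIdeal_pow fun j =>
      Ideal.mul_mem_right _ _ (Ideal.pow_le_pow_right j.le_succ (coe_omegaPoly_mem j))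
  refine ⟨∑' j, ((omegaPoly p j : ℤ_[p][X]) : Λ) * k j, fun m => ?_⟩
  choose q hq hq' using exists_coe_omegaPoly_add (p := p) m
  rw [← hs.sum_add_tsum_nat_add m, add_sub_cancel_left]
  refine ⟨∑' j, q j * k (j + m), ?_⟩
  rw [← Summable.tsum_mul_left]
  · simp_rw [hq', mul_assoc]
  · exact summable_of_mem_maximalIdeal_pow fun j => Ideal.mul_mem_right _ _ (hq j)

/-- The power series `(1 + T) ^ a`. -/
noncomputable abbrev onePlusPow (a : ℤ_[p]) : Λ := PowerSeries.binomialSeries ℤ_[p] a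

theorem onePlusPow_mul_nat (a : ℤ_[p]) (n : ℕ) : onePlusPow ((n : ℤ_[p]) * a) = onePlusPow a ^ n := by
  induction n with
  | zero => simp [onePlusPow]
  | succ n ih => rw [Nat.cast_succ, add_mul, one_mul, onePlusPow, PowerSeries.binomialSeries_add, pow_succ, ← ih]

/-- Write `a = p^m b` and approximate `b` by natural numbers. For a natural exponent the claim is a
geometric sum; the error lies in arbitrarily high powers of the maximal ideal, and ideals of `Λ` are
closed. -/
theorem onePlusPow_sub_one_mem (m : ℕ) {a : ℤ_[p]} (ha : PadicInt.toZModPow m a = 0) :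
    onePlusPow a - 1 ∈ Ideal.span {((omegaPoly p m : ℤ_[p][X]) : Λ)} := by
  have ha' : a ∈ RingHom.ker (PadicInt.toZModPow (p := p) m) := ha
  rw [PadicInt.ker_toZModPow, Ideal.mem_span_singleton] at ha'
  obtain ⟨b, rfl⟩ := ha'
  refine Ideal.mem_of_forall_mem_sup_pow _ fun N => ?_
  have hb : b - (b.appr N : ℤ_[p]) ∈ Ideal.span {(p : ℤ_[p]) ^ N} := PadicInt.appr_spec N b
  obtain ⟨c, hc⟩ := Ideal.mem_span_singleton.1 hb
  have e : (p : ℤ_[p]) ^ m * b = ((b.appr N : ℕ) : ℤ_[p]) * ((p ^ m : ℕ) : ℤ_[p]) +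
      ((p ^ (m + N) : ℕ) : ℤ_[p]) * c := by
    push_cast
    linear_combination (p : ℤ_[p]) ^ m * hc
  have e1 : onePlusPow (((b.appr N : ℕ) : ℤ_[p]) * ((p ^ m : ℕ) : ℤ_[p])) - 1 ∈
      Ideal.span {((omegaPoly p m : ℤ_[p][X]) : Λ)} := by
    rw [onePlusPow_mul_nat, onePlusPow, PowerSeries.binomialSeries_nat, Ideal.mem_span_singleton,
      coe_omegaPoly]
    exact sub_one_dvd_pow_sub_one _ _
  have e2 : onePlusPow (((p ^ (m + N) : ℕ) : ℤ_[p]) * c) - 1 ∈ 𝔪 ^ N := by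
    rw [onePlusPow_mul_nat]
    have hc : onePlusPow c - 1 ∈ 𝔪 := by
      rw [mem_maximalIdeal_powerSeries_iff]
      simp
    have := Ideal.one_add_pow_sub_one_mem 𝔪 natCast_mem_maximalIdeal_powerSeries hc (m + N)
    rw [add_sub_cancel] at this
    exact Ideal.pow_le_pow_right (by omega) this
  rw [e, onePlusPow, PowerSeries.binomialSeries_add]
  have : ∀ u v : Λ, u * v - 1 = (u - 1) * v + (v - 1) := fun u v => by ring
  rw [this]
  exact add_mem (Ideal.mem_sup_left (Ideal.mul_mem_right _ _ e1)) (Ideal.mem_sup_right e2)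

theorem onePlusPow_sub_mem (m : ℕ) {a b : ℤ_[p]}
    (h : PadicInt.toZModPow m a = PadicInt.toZModPow m b) :
    onePlusPow a - onePlusPow b ∈ Ideal.span {((omegaPoly p m : ℤ_[p][X]) : Λ)} := by
  have : onePlusPow a - onePlusPow b = onePlusPow b * (onePlusPow (a - b) - 1) := by
    rw [mul_sub, mul_one, onePlusPow, onePlusPow, onePlusPow, ← PowerSeries.binomialSeries_add,
      add_sub_cancel]
  rw [this]
  exact Ideal.mul_mem_left _ _ (onePlusPow_sub_one_mem m (by rw [map_sub, h, sub_self]))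

/-- After division by `p^μ` and reduction modulo `p`, the distinguished polynomial becomes `T^λ` and
the unit stays a unit. This makes `μ` and `λ` readable from the coefficients of `D`. -/
theorem coeff_of_associated_pow_mul_distinguished {D : Λ} {μ : ℕ} {G : ℤ_[p][X]}
    (hG : G.IsDistinguishedAt (IsLocalRing.maximalIdeal ℤ_[p]))
    (h : Associated D ((p : Λ) ^ μ * (G : Λ))) :
    (∀ n, (p : ℤ_[p]) ^ μ ∣ PowerSeries.coeff n D) ∧
    (∀ n < G.natDegree, (p : ℤ_[p]) ^ (μ + 1) ∣ PowerSeries.coeff n D) ∧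
    ¬ (p : ℤ_[p]) ^ (μ + 1) ∣ PowerSeries.coeff G.natDegree D := by
  obtain ⟨u, hu⟩ := h.symm
  have hp0 : (p : ℤ_[p]) ^ μ ≠ 0 := pow_ne_zero _ (Nat.cast_ne_zero.2 (Fact.out : p.Prime).ne_zero)
  have hc : ∀ n, PowerSeries.coeff n D = (p : ℤ_[p]) ^ μ * PowerSeries.coeff n ((G : Λ) * (u : Λ)) := by
    intro n
    have hp : (p : Λ) ^ μ = PowerSeries.C ((p : ℤ_[p]) ^ μ) := by simp
    rw [← hu, hp, mul_assoc, PowerSeries.coeff_C_mul]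
  have hmap : ((G : Λ) * (u : Λ)).map (IsLocalRing.residue ℤ_[p]) =
      PowerSeries.X ^ G.natDegree * (u : Λ).map (IsLocalRing.residue ℤ_[p]) := by
    rw [map_mul]
    congr 1
    have := congrArg (fun q : (ℤ_[p] ⧸ IsLocalRing.maximalIdeal ℤ_[p])[X] =>
      (q : PowerSeries (ℤ_[p] ⧸ IsLocalRing.maximalIdeal ℤ_[p]))) hG.map_eq_X_pow
    rw [Polynomial.coe_pow, Polynomial.coe_X] at this
    exact Polynomial.polynomial_map_coe.symm.trans this
  have hdvd : ∀ n, (p : ℤ_[p]) ^ (μ + 1) ∣ PowerSeries.coeff n D ↔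
      PowerSeries.coeff n (((G : Λ) * (u : Λ)).map (IsLocalRing.residue ℤ_[p])) = 0 := by
    intro n
    rw [hc, pow_succ, mul_dvd_mul_iff_left hp0, PowerSeries.coeff_map,
      IsLocalRing.residue_eq_zero_iff, PadicInt.maximalIdeal_eq_span_p, Ideal.mem_span_singleton]
  refine ⟨fun n => ⟨_, hc n⟩, fun n hn => ?_, ?_⟩
  · rw [hdvd, hmap, PowerSeries.coeff_X_pow_mul', if_neg (by omega)]
  · rw [hdvd, hmap, PowerSeries.coeff_X_pow_mul', if_pos le_rfl, Nat.sub_self,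
      PowerSeries.coeff_zero_eq_constantCoeff_apply]
    exact (((u.isUnit.map (PowerSeries.map (IsLocalRing.residue ℤ_[p]))).map
      (PowerSeries.constantCoeff)).ne_zero)

/-- If `μ' > μ`, the coefficient of `D'` at index `deg G` would be divisible by `p^(μ+1)`, contrary
to that of `D`. If `μ' = μ`, both degrees are the first index where this divisibility fails. -/
theorem invariants_le_of_coeff_sub {D D' : Λ} {μ μ' : ℕ} {G G' : ℤ_[p][X]}
    (hG : G.IsDistinguishedAt (IsLocalRing.maximalIdeal ℤ_[p]))
    (h : Associated D ((p : Λ) ^ μ * (G : Λ)))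
    (hG' : G'.IsDistinguishedAt (IsLocalRing.maximalIdeal ℤ_[p]))
    (h' : Associated D' ((p : Λ) ^ μ' * (G' : Λ)))
    (hD : ∀ n ≤ G.natDegree, (p : ℤ_[p]) ^ (μ + 1) ∣ PowerSeries.coeff n (D' - D)) :
    μ' ≤ μ ∧ (μ' = μ → G'.natDegree = G.natDegree) := by
  obtain ⟨h1, h2, h3⟩ := coeff_of_associated_pow_mul_distinguished hG h
  obtain ⟨h1', h2', h3'⟩ := coeff_of_associated_pow_mul_distinguished hG' h'
  have key : ∀ n ≤ G.natDegree, ((p : ℤ_[p]) ^ (μ + 1) ∣ PowerSeries.coeff n D' ↔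
      (p : ℤ_[p]) ^ (μ + 1) ∣ PowerSeries.coeff n D) := fun n hn => by
    have := hD n hn
    rw [map_sub] at this
    exact (dvd_iff_dvd_of_dvd_sub this)
  refine ⟨?_, ?_⟩
  · by_contra! hlt
    exact h3 ((key _ le_rfl).1 ((pow_dvd_pow _ hlt).trans (h1' _)))
  · rintro rfl
    refine le_antisymm ?_ ?_
    · by_contra! hlt
      exact h3 ((key _ le_rfl).1 (h2' _ hlt))
    · by_contra! hlt
      exact h3' ((key _ hlt.le).2 (h2 _ hlt))

end Adic

/-! ### Harmonic divisors on a finite connected multigraph -/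

section Laplacian

namespace Multigraph

variable {V E : Type*} [Fintype E] {R : Type*} [CommRing R]

/-- The Laplacian of a multigraph, the linear extension of `v ↦ p_v`. -/
noncomputable def laplacian (R : Type*) [CommRing R] (G : Multigraph V E) :
    Divisors R V →ₗ[R] Divisors R V :=
  Finsupp.linearCombination R (G.firing R)

theorem laplacian_vertexDivisor (G : Multigraph V E) (v : V) :
    G.laplacian R (vertexDivisor R v) = G.firing R v :=
  (Finsupp.linearCombination_single R (1 : R) v).trans (one_smul R _)

theorem range_laplacian (G : Multigraph V E) : LinearMap.range (G.laplacian R) = G.Pr R :=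
  Finsupp.range_linearCombination R

/-- The coefficient of a divisor at a vertex. -/
noncomputable def coeffMap (R : Type*) [CommRing R] (v : V) : Divisors R V →ₗ[R] R :=
  Finsupp.lapply v

open Classical in
theorem coeffMap_vertexDivisor (v w : V) :
    coeffMap R v (vertexDivisor R w) = if w = v then 1 else 0 :=
  Finsupp.single_apply

theorem divisors_hom_ext {M : Type*} [AddCommGroup M] [Module R M] {f g : Divisors R V →ₗ[R] M}
    (h : ∀ v, f (vertexDivisor R v) = g (vertexDivisor R v)) : f = g :=
  Finsupp.lhom_ext' fun v => LinearMap.ext_ring (h v)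

theorem divisors_ext {x y : Divisors R V} (h : ∀ v, coeffMap R v x = coeffMap R v y) : x = y :=
  Finsupp.ext h

theorem laplacian_eq_sum (G : Multigraph V E) (x : Divisors R V) :
    G.laplacian R x = ∑ e, (coeffMap R (G.src e) x - coeffMap R (G.tgt e) x) •
      (vertexDivisor R (G.src e) - vertexDivisor R (G.tgt e)) := by
  classical
  let f : Divisors R V →ₗ[R] Divisors R V := ∑ e,
    (coeffMap R (G.src e) - coeffMap R (G.tgt e)).smulRight
      (vertexDivisor R (G.src e) - vertexDivisor R (G.tgt e))
  have : G.laplacian R = f := by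
    refine divisors_hom_ext fun v => ?_
    rw [laplacian_vertexDivisor, firing, Finset.sum_filter, Finset.sum_filter,
      ← Finset.sum_add_distrib]
    simp only [f, LinearMap.sum_apply, LinearMap.smulRight_apply, LinearMap.sub_apply,
      coeffMap_vertexDivisor]
    refine Finset.sum_congr rfl fun e _ => ?_
    by_cases h1 : G.src e = v <;> by_cases h2 : G.tgt e = v
    · simp [h1, h2]
    · simp [h1, h2, Ne.symm h2]
    · simp [h1, h2, Ne.symm h1]
    · simp [h1, h2, Ne.symm h1, Ne.symm h2]
  rw [this]
  simp [f]

variable {p : ℕ} [Fact p.Prime]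

/-- The kernel of the Laplacian of a connected multigraph consists of the constant divisors. -/
theorem coeffMap_eq_of_laplacian_eq_zero [Fintype V] {G : Multigraph V E} (hG : G.Connected)
    {x : Divisors ℤ_[p] V} (hx : G.laplacian ℤ_[p] x = 0) (v w : V) :
    coeffMap ℤ_[p] v x = coeffMap ℤ_[p] w x := by
  classical
  have hedge : ∀ e, coeffMap ℤ_[p] (G.src e) x = coeffMap ℤ_[p] (G.tgt e) x := by
    -- Positivity is not available in `ℤ_p`. The Laplacian has integer coefficients, so every
    -- `ℚ`-linear functional `ℚ_p → ℚ` turns `x` into a rational harmonic function, to which the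
    -- energy argument applies; such functionals separate points.
    have key : ∀ (l : Module.Dual ℚ ℚ_[p]) (e : E),
        l (coeffMap ℤ_[p] (G.src e) x : ℤ_[p]) = l (coeffMap ℤ_[p] (G.tgt e) x : ℤ_[p]) := by
      intro l
      let c : V → ℚ := fun v => l (coeffMap ℤ_[p] v x : ℤ_[p])
      have hu : ∀ u, ∑ e, (c (G.src e) - c (G.tgt e)) *
          ((if G.src e = u then 1 else 0) - (if G.tgt e = u then 1 else 0)) = 0 := by
        intro u
        have h0 := congrArg (fun y => l ((coeffMap ℤ_[p] u y : ℤ_[p]) : ℚ_[p])) hx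
        simp only [laplacian_eq_sum, map_sum, map_smul, map_sub, coeffMap_vertexDivisor, map_zero,
          PadicInt.coe_zero, smul_eq_mul, PadicInt.coe_sum] at h0
        refine Eq.trans (Finset.sum_congr rfl fun e _ => ?_) h0
        split_ifs <;> simp [c]
      have hsum : ∑ e, (c (G.src e) - c (G.tgt e)) ^ 2 = 0 := by
        -- Pairing the harmonic function with its own Laplacian gives the energy, a sum of squares
        -- over the edges.
        have : ∑ u, c u * ∑ e, (c (G.src e) - c (G.tgt e)) *
          ((if G.src e = u then 1 else 0) - (if G.tgt e = u then 1 else 0)) = 0 := by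
          simp [hu]
        rw [← this]
        simp_rw [Finset.mul_sum]
        rw [Finset.sum_comm]
        refine Finset.sum_congr rfl fun e _ => ?_
        have : ∀ u, c u * ((c (G.src e) - c (G.tgt e)) *
            ((if G.src e = u then 1 else 0) - (if G.tgt e = u then 1 else 0))) =
            (c (G.src e) - c (G.tgt e)) * ((if G.src e = u then c u else 0) -
              (if G.tgt e = u then c u else 0)) := fun u => by split_ifs <;> ring
        simp_rw [this]
        rw [← Finset.mul_sum, Finset.sum_sub_distrib, Finset.sum_ite_eq, Finset.sum_ite_eq]
        simp [sq]
      intro e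
      have := (Finset.sum_eq_zero_iff_of_nonneg (fun e _ => sq_nonneg _)).1 hsum e (Finset.mem_univ e)
      exact sub_eq_zero.1 (pow_eq_zero_iff two_ne_zero |>.1 this)
    intro e
    have : ((coeffMap ℤ_[p] (G.src e) x : ℤ_[p]) : ℚ_[p]) - (coeffMap ℤ_[p] (G.tgt e) x : ℤ_[p]) = 0 :=
      (Module.forall_dual_apply_eq_zero_iff ℚ _).1 fun l => by rw [map_sub, key l e, sub_self]
    exact Subtype.ext (sub_eq_zero.1 this)
  induction hG.2 v w with
  | refl => rfl
  | tail _ h ih =>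
    rw [ih]
    obtain ⟨e, ⟨rfl, rfl⟩ | ⟨rfl, rfl⟩⟩ := h
    · exact hedge e
    · exact (hedge e).symm

end Multigraph

end Laplacian

/-! ### `Div(X_m)` as the free module over `Λ/(ω_m)` on the vertices -/

section LevelDivisors

namespace Multigraph

variable {V E : Type*} {p : ℕ} [Fact p.Prime]

local notation "Λ" => PowerSeries ℤ_[p]

/-- The module `Div(X_m)`, as a module over the Iwasawa algebra. -/
def LevelDivisors (V : Type*) (p : ℕ) [Fact p.Prime] (m : ℕ) : Type _ :=
  Divisors ℤ_[p] (V × ZMod (p ^ m))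

noncomputable instance (m : ℕ) : AddCommGroup (LevelDivisors V p m) :=
  inferInstanceAs (AddCommGroup (Divisors ℤ_[p] (V × ZMod (p ^ m))))

noncomputable instance (m : ℕ) : Module ℤ_[p] (LevelDivisors V p m) :=
  inferInstanceAs (Module ℤ_[p] (Divisors ℤ_[p] (V × ZMod (p ^ m))))

/-- The action of the generator `1` of `ℤ_p` on `Div(X_m)`. -/
noncomputable def divisorShift (V : Type*) (p : ℕ) [Fact p.Prime] (m : ℕ) :
    Module.End ℤ_[p] (LevelDivisors V p m) :=
  divisorMap ℤ_[p] (fun x : V × ZMod (p ^ m) => (x.1, x.2 + 1))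

/-- The vertex `(v, g)` of `X_m`, as a divisor. -/
noncomputable def levelVertex (m : ℕ) (v : V) (g : ZMod (p ^ m)) : LevelDivisors V p m :=
  vertexDivisor ℤ_[p] (v, g)

theorem levelDivisors_hom_ext {m : ℕ} {M : Type*} [AddCommGroup M] [Module ℤ_[p] M]
    {f g : LevelDivisors V p m →ₗ[ℤ_[p]] M} (h : ∀ v k, f (levelVertex m v k) = g (levelVertex m v k)) :
    f = g :=
  divisors_hom_ext (V := V × ZMod (p ^ m)) fun v => h v.1 v.2

theorem divisorShift_levelVertex (m : ℕ) (v : V) (g : ZMod (p ^ m)) :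
    divisorShift V p m (levelVertex m v g) = levelVertex m v (g + 1) :=
  divisorMap_vertexDivisor _ _ _

theorem divisorShift_pow_levelVertex (m k : ℕ) (v : V) (g : ZMod (p ^ m)) :
    (divisorShift V p m ^ k) (levelVertex m v g) = levelVertex m v (g + (k : ZMod (p ^ m))) := by
  induction k with
  | zero => simp
  | succ k ih =>
    rw [pow_succ', Module.End.mul_apply, ih, divisorShift_levelVertex, Nat.cast_succ, add_assoc]

theorem divisorShift_pow (m : ℕ) : divisorShift V p m ^ p ^ m = 1 := by
  refine levelDivisors_hom_ext fun v g => ?_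
  rw [divisorShift_pow_levelVertex, ZMod.natCast_self, add_zero, Module.End.one_apply]

noncomputable instance (m : ℕ) : Module Λ (LevelDivisors V p m) :=
  Module.compHom _ (iwasawaAction (divisorShift_pow (V := V) (p := p) m))

theorem levelDivisors_smul_def {m : ℕ} (f : Λ) (x : LevelDivisors V p m) :
    f • x = iwasawaAction (divisorShift_pow m) f x := rfl

theorem coe_smul_levelDivisors {m : ℕ} (q : ℤ_[p][X]) (x : LevelDivisors V p m) :
    (q : Λ) • x = aeval (divisorShift V p m - 1) q x := by
  rw [levelDivisors_smul_def, iwasawaAction_coe]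

theorem C_smul_levelDivisors {m : ℕ} (c : ℤ_[p]) (x : LevelDivisors V p m) :
    (PowerSeries.C c : Λ) • x = c • x := by
  rw [← Polynomial.coe_C, coe_smul_levelDivisors, aeval_C, Module.algebraMap_end_apply]

theorem omegaPoly_smul_levelDivisors {m : ℕ} (x : LevelDivisors V p m) :
    ((omegaPoly p m : ℤ_[p][X]) : Λ) • x = 0 := by
  rw [coe_smul_levelDivisors, aeval_omegaPoly (divisorShift_pow m), LinearMap.zero_apply]

theorem one_add_X_pow_smul_levelVertex {m : ℕ} (k : ℕ) (v : V) (g : ZMod (p ^ m)) :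
    ((1 + PowerSeries.X) ^ k : Λ) • levelVertex m v g = levelVertex m v (g + (k : ZMod (p ^ m))) := by
  have : ((1 + PowerSeries.X) ^ k : Λ) = (((1 + X) ^ k : ℤ_[p][X]) : Λ) := by simp
  rw [this, coe_smul_levelDivisors, map_pow, map_add, map_one, aeval_X, add_sub_cancel,
    divisorShift_pow_levelVertex]

/-- Modulo `ω_m`, which acts as zero, `a` may be replaced by a natural number with the same residue.
-/
theorem onePlusPow_smul_levelVertex {m : ℕ} (a : ℤ_[p]) (v : V) (g : ZMod (p ^ m)) :
    onePlusPow a • levelVertex m v g = levelVertex m v (g + PadicInt.toZModPow m a) := by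
  have h := onePlusPow_sub_mem (p := p) m (a := a) (b := ((PadicInt.toZModPow m a).val : ℤ_[p]))
    (by rw [map_natCast, ZMod.natCast_zmod_val])
  obtain ⟨c, hc⟩ := Ideal.mem_span_singleton.1 h
  rw [eq_add_of_sub_eq hc, add_smul, mul_smul, omegaPoly_smul_levelDivisors, zero_add, onePlusPow,
    PowerSeries.binomialSeries_nat, one_add_X_pow_smul_levelVertex, ZMod.natCast_zmod_val]

/-- Composition with `X + 1` makes `q` a polynomial in `γ = 1 + T`. Powers of `γ` below `p^m` move
`(v, 0)` to distinct vertices, so the coefficients of `q` can be read off. -/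
theorem coeffMap_polynomial_smul {m : ℕ} {q : ℤ_[p][X]} (hq : q.natDegree < p ^ m) (v w : V) {j : ℕ}
    (hj : j < p ^ m) [DecidableEq V] :
    coeffMap ℤ_[p] (w, (j : ZMod (p ^ m))) ((((q.comp (X + 1) : ℤ_[p][X]) : Λ)) • levelVertex m v 0 :
      LevelDivisors V p m) = if v = w then q.coeff j else 0 := by
  rw [coe_smul_levelDivisors, aeval_comp, map_add, map_one, aeval_X, sub_add_cancel,
    aeval_eq_sum_range' hq, LinearMap.sum_apply]
  have : ∀ i, (q.coeff i • divisorShift V p m ^ i) (levelVertex m v 0) =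
      q.coeff i • levelVertex m v (i : ZMod (p ^ m)) := fun i => by
    rw [LinearMap.smul_apply, divisorShift_pow_levelVertex, zero_add]
  simp_rw [this]
  refine (map_sum (coeffMap ℤ_[p] (w, (j : ZMod (p ^ m)))) _ _).trans ?_
  have h2 : ∀ i ∈ Finset.range (p ^ m), coeffMap ℤ_[p] (w, (j : ZMod (p ^ m)))
      (q.coeff i • levelVertex m v (i : ZMod (p ^ m))) =
      if i = j then (if v = w then q.coeff j else 0) else 0 := by
    intro i hi
    refine (map_smul (coeffMap ℤ_[p] (w, (j : ZMod (p ^ m)))) _ _).trans ?_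
    rw [levelVertex, coeffMap_vertexDivisor, Prod.mk.injEq, ZMod.natCast_eq_natCast_iff']
    rw [Nat.mod_eq_of_lt (Finset.mem_range.1 hi), Nat.mod_eq_of_lt hj]
    by_cases hij : i = j <;> by_cases hvw : v = w <;> simp [hij, hvw]
  rw [Finset.sum_congr rfl h2]
  simp [hj]

theorem natDegree_omegaPoly (m : ℕ) : (omegaPoly p m).natDegree = p ^ m := by
  have h1 : (X + 1 : ℤ_[p][X]).natDegree = 1 := by simpa using natDegree_X_add_C (1 : ℤ_[p])
  have h2 : ((X + 1 : ℤ_[p][X]) ^ p ^ m).natDegree = p ^ m := by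
    rw [(by simpa using monic_X_add_C (1 : ℤ_[p]) : (X + 1 : ℤ_[p][X]).Monic).natDegree_pow, h1,
      mul_one]
  rw [omegaPoly, natDegree_sub_eq_left_of_natDegree_lt, h2]
  rw [h2, natDegree_one]
  exact pow_pos (Fact.out : p.Prime).pos m

/-- The homomorphism `Λ^V → Div(X_m)` given by `e_v ↦ (v, 0)`. -/
noncomputable def theta (V : Type*) [Fintype V] (p : ℕ) [Fact p.Prime] (m : ℕ) :
    (V → PowerSeries ℤ_[p]) →ₗ[PowerSeries ℤ_[p]] LevelDivisors V p m :=
  Fintype.linearCombination (PowerSeries ℤ_[p]) (fun v => levelVertex m v 0)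

variable [Fintype V]

theorem theta_apply (m : ℕ) (f : V → Λ) : theta V p m f = ∑ v, f v • levelVertex m v 0 :=
  Fintype.linearCombination_apply _ _ _

theorem theta_single [DecidableEq V] (m : ℕ) (v : V) (a : Λ) :
    theta V p m (Pi.single v a) = a • levelVertex m v 0 :=
  Fintype.linearCombination_apply_single _ _ _ _

theorem theta_surjective (m : ℕ) : Function.Surjective (theta V p m) := by
  classical
  intro x
  induction x using Finsupp.induction_linear with
  | zero => exact ⟨0, map_zero _⟩
  | add x y hx hy =>
    obtain ⟨f, hf⟩ := hx
    obtain ⟨g, hg⟩ := hy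
    exact ⟨f + g, by rw [map_add, hf, hg]; rfl⟩
  | single vg c =>
    refine ⟨Pi.single vg.1 (PowerSeries.C c * (1 + PowerSeries.X) ^ vg.2.val), ?_⟩
    rw [theta_single, mul_smul, one_add_X_pow_smul_levelVertex, C_smul_levelDivisors, zero_add,
      ZMod.natCast_zmod_val]
    exact (Finsupp.smul_single _ _ _).trans (by simp)

/-- Weierstrass division by `ω_m` leaves a remainder of degree below `p^m`. Expanded in powers of `1
+ T`, its coefficients are those of the image divisor, so the remainder vanishes. -/
theorem omegaPoly_dvd_of_theta_eq_zero {m : ℕ} {f : V → Λ} (hf : theta V p m f = 0) (v : V) :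
    ((omegaPoly p m : ℤ_[p][X]) : Λ) ∣ f v := by
  classical
  have hω := omegaPoly_isDistinguishedAt p m
  have hdeg := natDegree_omegaPoly (p := p) m
  have hrep : ∀ F : Λ, ∃ (q : ℤ_[p][X]) (h : Λ), q.natDegree < p ^ m ∧
      F = ((q.comp (X + 1) : ℤ_[p][X]) : Λ) + (omegaPoly p m : ℤ_[p][X]) * h := by
    intro F
    obtain ⟨q, hq⟩ := Ideal.Quotient.mk_surjective
      (hω.algEquivQuotient.symm (Ideal.Quotient.mk (Ideal.span {(omegaPoly p m : Λ)}) F))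
    rw [AlgEquiv.eq_symm_apply, Polynomial.IsDistinguishedAt.algEquivQuotient_apply] at hq
    have hq' : Ideal.Quotient.mk (Ideal.span {(omegaPoly p m : Λ)}) (q : Λ) =
      Ideal.Quotient.mk _ F := by simpa using hq
    obtain ⟨b, hb⟩ := Ideal.mem_span_singleton'.1 (Ideal.Quotient.eq.1 hq'.symm)
    refine ⟨(q %ₘ omegaPoly p m).comp (X - 1), (q /ₘ omegaPoly p m : ℤ_[p][X]) + b, ?_, ?_⟩
    · rw [natDegree_comp]
      have h1 : (X - 1 : ℤ_[p][X]).natDegree = 1 := by simpa using natDegree_X_sub_C (1 : ℤ_[p])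
      rw [h1, mul_one, ← hdeg]
      refine natDegree_modByMonic_lt _ hω.monic fun h => ?_
      rw [h, natDegree_one] at hdeg
      exact (pow_pos (Fact.out : p.Prime).pos m).ne hdeg
    · rw [comp_assoc]
      have h2 : (X - 1 : ℤ_[p][X]).comp (X + 1) = X := by simp
      rw [h2, comp_X, mul_add, ← add_assoc, ← Polynomial.coe_mul, ← Polynomial.coe_add,
        modByMonic_add_div, mul_comm _ b, hb]
      ring
  choose q h hq hqh using hrep
  have hz : ∀ w, q (f w) = 0 := by
    intro w
    ext j
    rw [coeff_zero]
    by_cases hj : j < p ^ m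
    · have h1 : theta V p m f = ∑ u, ((((q (f u)).comp (X + 1) : ℤ_[p][X]) : Λ)) • levelVertex m u 0 := by
        rw [theta_apply]
        refine Finset.sum_congr rfl fun u _ => ?_
        conv_lhs => rw [hqh (f u)]
        rw [add_smul, mul_smul, omegaPoly_smul_levelDivisors, add_zero]
      have h2 := congrArg (coeffMap ℤ_[p] (w, (j : ZMod (p ^ m)))) (h1.symm.trans hf)
      have h3 := (map_sum (coeffMap ℤ_[p] (w, (j : ZMod (p ^ m)))) _ _).symm.trans h2
      rw [Finset.sum_congr rfl fun u _ => coeffMap_polynomial_smul (hq (f u)) u w hj] at h3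
      have h4 := h3.trans (map_zero _)
      simpa using h4
    · exact coeff_eq_zero_of_natDegree_lt ((hq _).trans_le (not_lt.1 hj))
  rw [hqh (f v), hz, zero_comp, Polynomial.coe_zero, zero_add]
  exact dvd_mul_right _ _

end Multigraph

end LevelDivisors

/-! ### The Laplacian over `Λ` and its nonvanishing determinant -/

section VoltageLaplacian

namespace Multigraph

variable {V E : Type*} {p : ℕ} [Fact p.Prime]

local notation "Λ" => PowerSeries ℤ_[p]

theorem iwasawaAction_of_eq_one {γ : Module.End ℤ_[p] ℤ_[p]} {m : ℕ} (h : γ ^ p ^ m = 1)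
    (hγ : γ = 1) (F : Λ) (x : ℤ_[p]) : iwasawaAction h F x = PowerSeries.constantCoeff F * x := by
  have hF := PowerSeries.eq_X_mul_shift_add_const F
  conv_lhs => rw [hF]
  rw [map_add, map_mul, iwasawaAction_X, ← Polynomial.coe_C, iwasawaAction_coe, sub_eq_zero.2 hγ,
    zero_mul, zero_add, aeval_C, Module.algebraMap_end_apply, smul_eq_mul]

/-- The degree of a divisor on `X_m`. -/
noncomputable def levelDegree (V : Type*) (p : ℕ) [Fact p.Prime] (m : ℕ) :
    LevelDivisors V p m →ₗ[ℤ_[p]] ℤ_[p] :=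
  degMap ℤ_[p] (V × ZMod (p ^ m))

theorem levelDegree_levelVertex (m : ℕ) (v : V) (g : ZMod (p ^ m)) :
    levelDegree V p m (levelVertex m v g) = 1 :=
  degMap_vertexDivisor _ _

theorem levelDegree_smul {m : ℕ} (F : Λ) (x : LevelDivisors V p m) :
    levelDegree V p m (F • x) = PowerSeries.constantCoeff F * levelDegree V p m x := by
  -- The degree is an equivariant map to `ℤ_p` with trivial action, treated as level `0`; there `T`
  -- acts as zero.
  have h1 : (1 : Module.End ℤ_[p] ℤ_[p]) ^ p ^ 0 = 1 := one_pow _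
  rw [levelDivisors_smul_def, iwasawaAction_comm (divisorShift_pow m) h1 (Nat.zero_le m)
    (levelDegree V p m) (fun x => degMap_divisorMap _ _ _), iwasawaAction_of_eq_one h1 rfl]

theorem levelDegree_theta [Fintype V] (m : ℕ) (f : V → Λ) :
    levelDegree V p m (theta V p m f) = ∑ v, PowerSeries.constantCoeff (f v) := by
  simp [theta_apply, levelDegree_smul, levelDegree_levelVertex]

/-- The projection `Div(X_{m+1}) → Div(X_m)`. -/
noncomputable def divisorProj (V : Type*) (p : ℕ) [Fact p.Prime] (m : ℕ) :
    LevelDivisors V p (m + 1) →ₗ[ℤ_[p]] LevelDivisors V p m :=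
  divisorMap ℤ_[p] (fun y : V × ZMod (p ^ (m + 1)) => (y.1, zmodProj p m y.2))

theorem divisorProj_levelVertex (m : ℕ) (v : V) (g : ZMod (p ^ (m + 1))) :
    divisorProj V p m (levelVertex (m + 1) v g) = levelVertex m v (zmodProj p m g) :=
  divisorMap_vertexDivisor _ _ _

theorem divisorProj_smul {m : ℕ} (F : Λ) (x : LevelDivisors V p (m + 1)) :
    divisorProj V p m (F • x) = F • divisorProj V p m x := by
  refine iwasawaAction_comm (divisorShift_pow (m + 1)) (divisorShift_pow m) m.le_succ _ ?_ F x
  intro x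
  refine LinearMap.congr_fun (f := divisorProj V p m ∘ₗ divisorShift V p (m + 1))
    (g := divisorShift V p m ∘ₗ divisorProj V p m) (levelDivisors_hom_ext fun v g => ?_) x
  simp only [LinearMap.comp_apply, divisorShift_levelVertex, divisorProj_levelVertex, map_add,
    map_one]

theorem divisorProj_theta [Fintype V] (m : ℕ) (f : V → Λ) :
    divisorProj V p m (theta V p (m + 1) f) = theta V p m f := by
  simp [theta_apply, divisorProj_smul, divisorProj_levelVertex]

theorem eq_zero_of_forall_theta_eq_zero [Fintype V] {f : V → Λ} (h : ∀ m, theta V p m f = 0) : f = 0 := by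
  funext v
  refine (Submodule.mem_bot Λ).1 (Ideal.mem_of_forall_mem_sup_pow (⊥ : Ideal Λ) fun N => ?_)
  obtain ⟨c, hc⟩ := omegaPoly_dvd_of_theta_eq_zero (h N) v
  rw [bot_sup_eq, hc]
  exact Ideal.mul_mem_right _ _ (Ideal.pow_le_pow_right N.le_succ (coe_omegaPoly_mem N))

theorem levelDegree_eq_card_mul [Fintype V] {m : ℕ} {x : LevelDivisors V p m} {c : ℤ_[p]}
    (hx : ∀ y, coeffMap ℤ_[p] y (show Divisors ℤ_[p] (V × ZMod (p ^ m)) from x) = c) :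
    levelDegree V p m x = (p : ℤ_[p]) ^ m * (Fintype.card V * c) := by
  have h1 : ∀ x : Divisors ℤ_[p] (V × ZMod (p ^ m)), degMap ℤ_[p] _ x = ∑ y, coeffMap ℤ_[p] y x := by
    intro x
    have : degMap ℤ_[p] (V × ZMod (p ^ m)) = ∑ y, coeffMap ℤ_[p] y :=
      divisors_hom_ext fun v => by
        rw [degMap_vertexDivisor, LinearMap.sum_apply, Finset.sum_eq_single v]
        · rw [coeffMap_vertexDivisor, if_pos rfl]
        · intro w _ hw
          rw [coeffMap_vertexDivisor, if_neg hw.symm]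
        · simp
    rw [this, LinearMap.sum_apply]
  refine (h1 x).trans ?_
  rw [Finset.sum_congr rfl fun y _ => hx y]
  simp [ZMod.card]
  ring

variable [Fintype E] (X : Multigraph V E) (α : E → ℤ_[p])

/-- The Laplacian of `X_m`. -/
noncomputable def levelLaplacian (m : ℕ) : LevelDivisors V p m →ₗ[ℤ_[p]] LevelDivisors V p m :=
  (X.derived α m).laplacian ℤ_[p]

theorem levelLaplacian_levelVertex (m : ℕ) (v : V) (g : ZMod (p ^ m)) :
    X.levelLaplacian α m (levelVertex m v g) = (X.derived α m).firing ℤ_[p] (v, g) :=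
  laplacian_vertexDivisor _ _

theorem levelLaplacian_smul {m : ℕ} (F : Λ) (x : LevelDivisors V p m) :
    X.levelLaplacian α m (F • x) = F • X.levelLaplacian α m x := by
  refine iwasawaAction_comm (divisorShift_pow m) (divisorShift_pow m) le_rfl _ ?_ F x
  intro x
  refine LinearMap.congr_fun (f := X.levelLaplacian α m ∘ₗ divisorShift V p m)
    (g := divisorShift V p m ∘ₗ X.levelLaplacian α m) (levelDivisors_hom_ext fun v g => ?_) x
  simp only [LinearMap.comp_apply, divisorShift_levelVertex, levelLaplacian_levelVertex]
  exact ((X.isCovering_shift α m).map_firing ℤ_[p] (v, g)).symm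

theorem levelDegree_levelLaplacian (m : ℕ) (x : LevelDivisors V p m) :
    levelDegree V p m (X.levelLaplacian α m x) = 0 := by
  have h : (X.derived α m).laplacian ℤ_[p] x ∈ (X.derived α m).Pr ℤ_[p] := by
    rw [← range_laplacian]
    exact ⟨_, rfl⟩
  exact Pr_le_Div0 _ _ h

variable [DecidableEq V]

/-- The column of the voltage Laplacian which belongs to the vertex `v`. -/
noncomputable def firingVector (v : V) : V → PowerSeries ℤ_[p] :=
  (∑ e ∈ Finset.univ.filter (fun e => X.src e = v),
      (Pi.single v 1 - Pi.single (X.tgt e) (onePlusPow (α e)))) +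
  (∑ e ∈ Finset.univ.filter (fun e => X.tgt e = v),
      (Pi.single v 1 - Pi.single (X.src e) (onePlusPow (-α e))))

/-- The Laplacian `D - A_α` of `X` with coefficients in `Λ`, where the edge `e` contributes
`(1 + T) ^ α(e)`. -/
noncomputable def voltageLaplacian : Matrix V V (PowerSeries ℤ_[p]) :=
  Matrix.of fun w v => X.firingVector α v w

variable [Fintype V]

theorem theta_firingVector (m : ℕ) (v : V) :
    theta V p m (X.firingVector α v) = (X.derived α m).firing ℤ_[p] (v, 0) := by
  rw [firingVector, map_add, map_sum, map_sum, firing]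
  refine congrArg₂ (· + ·) ?_ ?_
  · refine Finset.sum_bij' (fun e _ => (e, 0)) (fun e _ => e.1) ?_ ?_ ?_ ?_ ?_
    · intro e he
      simpa [derived] using he
    · rintro ⟨e, k⟩ he
      simp only [derived, Finset.mem_filter, Finset.mem_univ, true_and, Prod.mk.injEq] at he
      simpa using he.1
    · intro e he
      rfl
    · rintro ⟨e, k⟩ he
      simp only [derived, Finset.mem_filter, Finset.mem_univ, true_and, Prod.mk.injEq] at he
      simp [he.2]
    · intro e he
      rw [map_sub, theta_single, theta_single, one_smul, onePlusPow_smul_levelVertex]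
      rfl
  -- The lift of `e` that ends at `(v, 0)` starts in the sheet `-α(e)`; hence the exponent `-α e` in
  -- the incoming terms.
  · refine Finset.sum_bij' (fun e _ => (e, -PadicInt.toZModPow m (α e))) (fun e _ => e.1) ?_ ?_ ?_ ?_ ?_
    · intro e he
      simpa [derived] using he
    · rintro ⟨e, k⟩ he
      simp only [derived, Finset.mem_filter, Finset.mem_univ, true_and, Prod.mk.injEq] at he
      simpa using he.1
    · intro e he
      rfl
    · rintro ⟨e, k⟩ he
      simp only [derived, Finset.mem_filter, Finset.mem_univ, true_and, Prod.mk.injEq] at he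
      simp [eq_neg_of_add_eq_zero_left he.2]
    · intro e he
      rw [map_sub, theta_single, theta_single, one_smul, onePlusPow_smul_levelVertex, map_neg,
        zero_add]
      rfl

theorem levelLaplacian_theta (m : ℕ) (f : V → Λ) :
    X.levelLaplacian α m (theta V p m f) =
      theta V p m ((X.voltageLaplacian α).mulVec f) := by
  have h : (X.voltageLaplacian α).mulVec f = ∑ v, f v • X.firingVector α v := by
    ext w
    simp [voltageLaplacian, Matrix.mulVec, dotProduct, mul_comm]
  rw [h, theta_apply, map_sum, map_sum]
  refine Finset.sum_congr rfl fun v _ => ?_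
  rw [levelLaplacian_smul, levelLaplacian_levelVertex, map_smul, theta_firingVector]

theorem mem_Pr_derived_iff {m : ℕ} {x : LevelDivisors V p m} :
    (show Divisors ℤ_[p] (V × ZMod (p ^ m)) from x) ∈ (X.derived α m).Pr ℤ_[p] ↔
      ∃ f, theta V p m ((X.voltageLaplacian α).mulVec f) = x := by
  rw [← range_laplacian]
  constructor
  · rintro ⟨y, hy⟩
    obtain ⟨f, rfl⟩ := theta_surjective m (show LevelDivisors V p m from y)
    exact ⟨f, (X.levelLaplacian_theta α m f).symm.trans hy⟩
  · rintro ⟨f, rfl⟩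
    exact ⟨theta V p m f, X.levelLaplacian_theta α m f⟩

/-- A kernel vector maps to a harmonic, hence constant, divisor on each connected `X_m`. Its degree
is the same at all levels and is a multiple of `p^m` at level `m`, so it is zero. All these
constants then vanish, and with them the vector. -/
theorem voltageLaplacian_det_ne_zero (hα : α ∈ X.voltageCovers p) :
    (X.voltageLaplacian α).det ≠ 0 := by
  intro hdet
  have hne : Nonempty V := by
    obtain ⟨⟨v, -⟩⟩ := (hα 0).1
    exact ⟨v⟩
  obtain ⟨f, hf0, hf⟩ := Matrix.exists_mulVec_eq_zero_iff.2 hdet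
  refine hf0 (eq_zero_of_forall_theta_eq_zero fun m => ?_)
  have hconst : ∀ m, ∃ c, ∀ y, coeffMap ℤ_[p] y
      (show Divisors ℤ_[p] (V × ZMod (p ^ m)) from theta V p m f) = c := by
    intro m
    obtain ⟨y0⟩ := (hα m).1
    refine ⟨_, fun y => coeffMap_eq_of_laplacian_eq_zero (hα m) ?_ y y0⟩
    refine (X.levelLaplacian_theta α m f).trans ?_
    rw [hf, map_zero]
    rfl
  have hdeg : ∑ v, PowerSeries.constantCoeff (f v) = (0 : ℤ_[p]) := by
    refine (Submodule.mem_bot ℤ_[p]).1 (Ideal.mem_of_forall_mem_sup_pow (⊥ : Ideal ℤ_[p]) fun N => ?_)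
    obtain ⟨c, hc⟩ := hconst N
    rw [bot_sup_eq, ← levelDegree_theta N, levelDegree_eq_card_mul hc, PadicInt.maximalIdeal_eq_span_p,
      Ideal.span_singleton_pow]
    exact Ideal.mul_mem_right _ _ (Ideal.mem_span_singleton_self _)
  obtain ⟨c, hc⟩ := hconst m
  have hc0 : c = 0 := by
    rw [← levelDegree_theta m, levelDegree_eq_card_mul hc, mul_eq_zero, mul_eq_zero] at hdeg
    rcases hdeg with h | h | h
    · exact absurd h (pow_ne_zero _ (Nat.cast_ne_zero.2 (Fact.out : p.Prime).ne_zero))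
    · exact absurd h (Nat.cast_ne_zero.2 Fintype.card_ne_zero)
    · exact h
  exact divisors_ext (V := V × ZMod (p ^ m)) fun y => (hc y).trans (hc0.trans (map_zero _).symm)

end Multigraph

end VoltageLaplacian

/-! ### The Iwasawa module as a cokernel, and its dependence on the voltages -/

section IwasawaJacobian

namespace Multigraph

variable {V E : Type*} [Fintype E] {p : ℕ} [Fact p.Prime] (X : Multigraph V E) (α : E → ℤ_[p])

local notation "Λ" => PowerSeries ℤ_[p]

/-- The `Λ`-actions on divisors and on Jacobians are defined separately; both are compared with the
action on `Div⁰(X_m)`, from which there are equivariant maps to each. -/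
theorem smul_levelMk (m : ℕ) (F : Λ) (x : LevelDivisors V p m) (hx : levelDegree V p m x = 0)
    (hx' : levelDegree V p m (F • x) = 0) :
    F • levelMk X α m ⟨x, hx⟩ = levelMk X α m ⟨F • x, hx'⟩ := by
  let γ : Module.End ℤ_[p] (Div0 ℤ_[p] (V × ZMod (p ^ m))) := div0Map ℤ_[p] (fun y => (y.1, y.2 + 1))
  let ι : Div0 ℤ_[p] (V × ZMod (p ^ m)) →ₗ[ℤ_[p]] LevelDivisors V p m := Submodule.subtype _
  have hι : ∀ y, ι (γ y) = divisorShift V p m (ι y) := fun y => rfl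
  have hpow : ∀ k y, ι ((γ ^ k) y) = (divisorShift V p m ^ k) (ι y) := by
    intro k
    induction k with
    | zero => exact fun y => rfl
    | succ k ih =>
      intro y
      rw [pow_succ', pow_succ', Module.End.mul_apply, Module.End.mul_apply, hι, ih]
  have hγ : γ ^ p ^ m = 1 := LinearMap.ext fun y => Subtype.ext <| by
    refine (hpow (p ^ m) y).trans ?_
    rw [divisorShift_pow]
    rfl
  rw [powerSeries_smul_def, ← iwasawaAction_comm hγ (levelShift_pow X α m) le_rfl _
    (fun y => (levelShift_mk X α m y).symm)]
  congr 1
  exact Subtype.ext (iwasawaAction_comm hγ (divisorShift_pow m) le_rfl ι hι F _)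

variable [Fintype V]

/-- The submodule of `Λ^V` of vectors whose images in the modules `Div(X_m)` have degree zero. -/
noncomputable def degreeZero (V : Type*) [Fintype V] (p : ℕ) [Fact p.Prime] :
    Submodule (PowerSeries ℤ_[p]) (V → PowerSeries ℤ_[p]) where
  carrier := {f | ∑ v, PowerSeries.constantCoeff (f v) = 0}
  add_mem' := by
    intro f g hf hg
    simp only [Set.mem_ofPred_eq, Pi.add_apply, map_add, Finset.sum_add_distrib] at *
    rw [hf, hg, add_zero]
  zero_mem' := by simp
  smul_mem' := by
    intro a f hf
    simp only [Set.mem_ofPred_eq, Pi.smul_apply, smul_eq_mul, map_mul, ← Finset.mul_sum] at *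
    rw [hf, mul_zero]

theorem mem_degreeZero {f : V → Λ} :
    f ∈ degreeZero V p ↔ ∑ v, PowerSeries.constantCoeff (f v) = 0 := Iff.rfl

theorem mem_degreeZero_iff (m : ℕ) {f : V → Λ} :
    f ∈ degreeZero V p ↔ levelDegree V p m (theta V p m f) = 0 := by
  rw [mem_degreeZero, levelDegree_theta]

theorem levelMk_eq_iff [DecidableEq V] (m : ℕ) (x y : LevelDivisors V p m)
    (hx : levelDegree V p m x = 0) (hy : levelDegree V p m y = 0) :
    levelMk X α m ⟨x, hx⟩ = levelMk X α m ⟨y, hy⟩ ↔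
      ∃ f, theta V p m ((X.voltageLaplacian α).mulVec f) = x - y := by
  rw [← mem_Pr_derived_iff]
  exact Submodule.Quotient.eq _

/-- The homomorphism from vectors of degree zero to `J(X_m)`. -/
noncomputable def thetaJacobian (m : ℕ) : degreeZero V p →ₗ[Λ] X.LevelJacobian α m where
  toFun f := levelMk X α m ⟨theta V p m f, (mem_degreeZero_iff m).1 f.2⟩
  map_add' f g := by
    rw [← map_add]
    congr 1
    exact Subtype.ext (map_add (theta V p m) _ _)
  map_smul' F f := by
    rw [RingHom.id_apply, smul_levelMk]
    · congr 1
      exact Subtype.ext (map_smul (theta V p m) _ _)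
    · rw [← map_smul]
      exact (mem_degreeZero_iff m).1 ((degreeZero V p).smul_mem F f.2)

theorem thetaJacobian_apply (m : ℕ) (f : degreeZero V p) :
    X.thetaJacobian α m f = levelMk X α m ⟨theta V p m f, (mem_degreeZero_iff m).1 f.2⟩ := rfl

theorem thetaJacobian_surjective (m : ℕ) : Function.Surjective (X.thetaJacobian α m) := by
  intro y
  obtain ⟨⟨x, hx⟩, rfl⟩ := levelMk_surjective X α m y
  obtain ⟨f, hf⟩ := theta_surjective m (show LevelDivisors V p m from x)
  have hx' : levelDegree V p m (theta V p m f) = 0 := by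
    rw [hf]
    exact hx
  refine ⟨⟨f, (mem_degreeZero_iff m).2 hx'⟩, ?_⟩
  rw [thetaJacobian_apply]
  congr 1
  exact Subtype.ext hf

theorem levelProj_thetaJacobian (m : ℕ) (f : degreeZero V p) :
    levelProj X α m (X.thetaJacobian α (m + 1) f) = X.thetaJacobian α m f := by
  rw [thetaJacobian_apply, levelProj_mk, thetaJacobian_apply]
  congr 1
  exact Subtype.ext (divisorProj_theta m _)

/-- The homomorphism from vectors of degree zero to `J_∞(X_∞)`. -/
noncomputable def thetaInfinity : degreeZero V p →ₗ[Λ] X.iwasawaJacobian α :=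
  (LinearMap.pi (X.thetaJacobian α)).codRestrict _ fun f m => X.levelProj_thetaJacobian α m f

theorem thetaInfinity_coe (f : degreeZero V p) (m : ℕ) :
    (X.thetaInfinity α f : ∀ m, X.LevelJacobian α m) m = X.thetaJacobian α m f := rfl

variable [DecidableEq V]

theorem thetaJacobian_eq_iff {m : ℕ} {f g : degreeZero V p} :
    X.thetaJacobian α m f = X.thetaJacobian α m g ↔ ∃ h : V → Λ, ∀ v,
      ((omegaPoly p m : ℤ_[p][X]) : Λ) ∣ (f : V → Λ) v - (g : V → Λ) v -
        (X.voltageLaplacian α).mulVec h v := by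
  rw [thetaJacobian_apply, thetaJacobian_apply, levelMk_eq_iff]
  refine exists_congr fun h => ⟨fun e v => ?_, fun hv => ?_⟩
  · refine omegaPoly_dvd_of_theta_eq_zero
      (f := (f : V → Λ) - (g : V → Λ) - (X.voltageLaplacian α).mulVec h) ?_ v
    rw [map_sub, map_sub, e, sub_self]
  · choose k hk using hv
    have : (f : V → Λ) - (g : V → Λ) = (X.voltageLaplacian α).mulVec h +
        ((omegaPoly p m : ℤ_[p][X]) : Λ) • k := by
      funext v
      rw [Pi.add_apply, Pi.smul_apply, smul_eq_mul, ← hk v, Pi.sub_apply]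
      ring
    rw [← map_sub, this, map_add, map_smul, omegaPoly_smul_levelDivisors, add_zero]

theorem voltageLaplacian_mulVec_mem (f : V → Λ) :
    (X.voltageLaplacian α).mulVec f ∈ degreeZero V p := by
  rw [mem_degreeZero_iff 0, ← levelLaplacian_theta, levelDegree_levelLaplacian]

/-- Vanishing at level `N` puts `f` in the image of the Laplacian up to a multiple of `ω_N`. Since
`ω_N` tends to zero adically and submodules of `Λ^V` are closed, the error disappears. -/
theorem thetaInfinity_eq_zero_iff {f : degreeZero V p} :
    X.thetaInfinity α f = 0 ↔ ∃ h, (X.voltageLaplacian α).mulVec h = f := by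
  constructor
  · intro hf
    refine Submodule.mem_of_forall_mem_sup_pow_smul
      (LinearMap.range (X.voltageLaplacian α).mulVecLin) fun N => ?_
    have h1 : X.thetaJacobian α N f = X.thetaJacobian α N 0 := by
      rw [map_zero, ← thetaInfinity_coe, hf]
      rfl
    obtain ⟨h, hh⟩ := (X.thetaJacobian_eq_iff α).1 h1
    choose k hk using hh
    have : (f : V → Λ) = (X.voltageLaplacian α).mulVec h + ((omegaPoly p N : ℤ_[p][X]) : Λ) • k := by
      funext v
      rw [Pi.add_apply, Pi.smul_apply, smul_eq_mul, ← hk v]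
      simp
    rw [this]
    exact add_mem (Submodule.mem_sup_left ⟨h, rfl⟩) (Submodule.mem_sup_right
      (Submodule.smul_mem_smul (Ideal.pow_le_pow_right N.le_succ (coe_omegaPoly_mem N)) trivial))
  · rintro ⟨h, hh⟩
    refine Subtype.ext (funext fun m => ?_)
    rw [thetaInfinity_coe]
    refine Eq.trans ((X.thetaJacobian_eq_iff α).2 ⟨h, fun v => ?_⟩) (map_zero _)
    rw [hh]
    simp

/-- Lifts at consecutive levels differ by a Laplacian value and a multiple of `ω_m`. The multiples
of `ω_m` are summed to a convergent correction `F`. The Laplacian values need not converge: at level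
`m` only the first `m` of them occur, and they vanish in the Jacobian. -/
theorem thetaInfinity_surjective : Function.Surjective (X.thetaInfinity α) := by
  intro y
  choose f hf using fun m => X.thetaJacobian_surjective α m
    ((y : ∀ m, X.LevelJacobian α m) m)
  have hstep : ∀ m, X.thetaJacobian α m (f (m + 1)) = X.thetaJacobian α m (f m) := by
    intro m
    rw [← levelProj_thetaJacobian, hf, hf]
    exact y.2 m
  choose h hh using fun m => (X.thetaJacobian_eq_iff α).1 (hstep m)
  choose k hk using hh
  choose F hF using fun v => exists_omegaPoly_dvd_sub_sum (fun j => k j v)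
  have hsum : ∀ m v, (f m : V → Λ) v = (f 0 : V → Λ) v +
      ∑ j ∈ Finset.range m, (X.voltageLaplacian α).mulVec (h j) v +
      ∑ j ∈ Finset.range m, ((omegaPoly p j : ℤ_[p][X]) : Λ) * k j v := by
    intro m v
    induction m with
    | zero => simp
    | succ m ih =>
      rw [Finset.sum_range_succ, Finset.sum_range_succ, ← hk m v]
      linear_combination ih
  have key : ∀ m v, ((omegaPoly p m : ℤ_[p][X]) : Λ) ∣ ((f 0 : V → Λ) + F) v - (f m : V → Λ) v -
      (X.voltageLaplacian α).mulVec (-∑ j ∈ Finset.range m, h j) v := by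
    intro m v
    have e : ((f 0 : V → Λ) + F) v - (f m : V → Λ) v -
        (X.voltageLaplacian α).mulVec (-∑ j ∈ Finset.range m, h j) v =
        F v - ∑ j ∈ Finset.range m, ((omegaPoly p j : ℤ_[p][X]) : Λ) * k j v := by
      have : (X.voltageLaplacian α).mulVec (∑ j ∈ Finset.range m, h j) v =
          ∑ j ∈ Finset.range m, (X.voltageLaplacian α).mulVec (h j) v := by
        rw [Matrix.mulVec_sum, Finset.sum_apply]
      rw [Matrix.mulVec_neg, Pi.neg_apply, this, hsum m v, Pi.add_apply]
      ring
    rw [e]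
    exact hF v m
  have hmem : (f 0 : V → Λ) + F ∈ degreeZero V p := by
    -- The case `m = 0` of the construction says that `ω_0 = T` divides every entry of `F`.
    have hF0 : F ∈ degreeZero V p := by
      refine Finset.sum_eq_zero fun v _ => ?_
      obtain ⟨c, hc⟩ := hF v 0
      rw [Finset.range_zero, Finset.sum_empty, sub_zero] at hc
      rw [hc, coe_omegaPoly]
      simp
    exact add_mem (f 0).2 hF0
  refine ⟨⟨_, hmem⟩, Subtype.ext (funext fun m => ?_)⟩
  rw [thetaInfinity_coe, ← hf m, thetaJacobian_eq_iff]
  exact ⟨_, key m⟩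

/-- The matrix of an isomorphism from `Λ^V` to the vectors of degree zero. -/
noncomputable def degreeZeroMatrix (p : ℕ) [Fact p.Prime] (v₀ : V) :
    Matrix V V (PowerSeries ℤ_[p]) :=
  Matrix.updateRow 1 v₀ (Function.update (fun _ => -1) v₀ PowerSeries.X)

theorem degreeZeroMatrix_det (v₀ : V) : (degreeZeroMatrix p v₀).det = PowerSeries.X := by
  rw [degreeZeroMatrix, ← Matrix.det_transpose, ← Matrix.updateCol_transpose, Matrix.transpose_one,
    ← Matrix.cramer_apply, Matrix.cramer_one, Module.End.one_apply, Function.update_self]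

theorem sum_degreeZeroMatrix_mulVec (v₀ : V) (f : V → Λ) :
    ∑ v, (degreeZeroMatrix p v₀).mulVec f v = PowerSeries.X * f v₀ := by
  have hne : ∀ v ∈ Finset.univ.erase v₀, (degreeZeroMatrix p v₀).mulVec f v = f v := fun v hv => by
    rw [degreeZeroMatrix, Matrix.mulVec, Matrix.updateRow_ne (Finset.ne_of_mem_erase hv)]
    exact congrFun (Matrix.one_mulVec f) v
  rw [← Finset.add_sum_erase _ _ (Finset.mem_univ v₀), Finset.sum_congr rfl hne, degreeZeroMatrix,
    Matrix.mulVec, Matrix.updateRow_self, dotProduct, ← Finset.add_sum_erase _ _ (Finset.mem_univ v₀),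
    Function.update_self]
  have : ∀ v ∈ Finset.univ.erase v₀,
      Function.update (fun _ => (-1 : Λ)) v₀ PowerSeries.X v * f v = - f v := fun v hv => by
    rw [Function.update_of_ne (Finset.ne_of_mem_erase hv), neg_one_mul]
  rw [Finset.sum_congr rfl this, Finset.sum_neg_distrib]
  ring

/-- Degree zero means that the sum of the entries is divisible by `T`. The preimage keeps the
entries away from `v₀` and has the quotient of that sum by `T` at `v₀`. -/
theorem mem_degreeZero_iff_exists (v₀ : V) {f : V → Λ} :
    f ∈ degreeZero V p ↔ ∃ g, (degreeZeroMatrix p v₀).mulVec g = f := by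
  rw [mem_degreeZero, ← map_sum]
  constructor
  · intro hf
    obtain ⟨c, hc⟩ := PowerSeries.X_dvd_iff.2 hf
    have hne : ∀ v, v ≠ v₀ → (degreeZeroMatrix p v₀).mulVec (Function.update f v₀ c) v = f v :=
      fun v hv => by
        rw [degreeZeroMatrix, Matrix.mulVec, Matrix.updateRow_ne hv]
        exact (congrFun (Matrix.one_mulVec _) v).trans (Function.update_of_ne hv _ _)
    refine ⟨Function.update f v₀ c, funext fun v => ?_⟩
    by_cases hv : v = v₀
    · subst hv
      have h1 := sum_degreeZeroMatrix_mulVec v (Function.update f v c)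
      rw [Function.update_self, ← hc, ← Finset.add_sum_erase _ _ (Finset.mem_univ v),
        ← Finset.add_sum_erase _ f (Finset.mem_univ v),
        Finset.sum_congr rfl fun w hw => hne w (Finset.ne_of_mem_erase hw)] at h1
      exact add_right_cancel h1
    · exact hne v hv
  · rintro ⟨g, rfl⟩
    rw [sum_degreeZeroMatrix_mulVec]
    simp

theorem exists_degreeZeroMatrix_mul_eq (v₀ : V) :
    ∃ P, degreeZeroMatrix p v₀ * P = X.voltageLaplacian α := by
  choose g hg using fun v => (mem_degreeZero_iff_exists v₀).1
    (X.voltageLaplacian_mulVec_mem α (Pi.single v 1))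
  refine ⟨Matrix.of fun w v => g v w, Matrix.ext_of_mulVec_single fun v => ?_⟩
  rw [← Matrix.mulVec_mulVec, ← hg v]
  congr 1
  ext w
  simp

/-- `J_∞(X_∞)` is the cokernel of a square matrix whose determinant is that of the Laplacian,
divided by `T`. -/
theorem nonempty_iwasawaJacobian_equiv (v₀ : V) {P : Matrix V V Λ}
    (hP : degreeZeroMatrix p v₀ * P = X.voltageLaplacian α) :
    Nonempty (X.iwasawaJacobian α ≃ₗ[Λ] ((V → Λ) ⧸ LinearMap.range P.mulVecLin)) := by
  let β : (V → Λ) →ₗ[Λ] degreeZero V p := (degreeZeroMatrix p v₀).mulVecLin.codRestrict _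
    fun f => (mem_degreeZero_iff_exists v₀).2 ⟨f, rfl⟩
  have hβ : ∀ f, (β f : V → Λ) = (degreeZeroMatrix p v₀).mulVec f := fun f => rfl
  have hinj : Function.Injective (degreeZeroMatrix p v₀).mulVec :=
    Matrix.mulVec_injective_of_det_ne_zero (by rw [degreeZeroMatrix_det]; exact PowerSeries.X_ne_zero)
  have hsurj : Function.Surjective (X.thetaInfinity α ∘ₗ β) := by
    refine (X.thetaInfinity_surjective α).comp fun f => ?_
    obtain ⟨g, hg⟩ := (mem_degreeZero_iff_exists v₀).1 f.2
    exact ⟨g, Subtype.ext hg⟩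
  have hker : LinearMap.range P.mulVecLin = LinearMap.ker (X.thetaInfinity α ∘ₗ β) := by
    ext f
    rw [LinearMap.mem_ker, LinearMap.comp_apply, thetaInfinity_eq_zero_iff, LinearMap.mem_range]
    refine exists_congr fun h => ?_
    rw [hβ, ← hP, ← Matrix.mulVec_mulVec, hinj.eq_iff, Matrix.mulVecLin_apply]
  exact ⟨((Submodule.quotEquivOfEq _ _ hker).trans
    (LinearMap.quotKerEquivOfSurjective _ hsurj)).symm⟩

/-- The equation for `T * D` pins `D` down independently of the base vertex and of `P`, so that the
series of different covers can be compared. -/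
theorem exists_invariants_of_mem_voltageCovers (hα : α ∈ X.voltageCovers p) :
    ∃ (D : Λ) (G : ℤ_[p][X]), PowerSeries.X * D = (X.voltageLaplacian α).det ∧
      G.IsDistinguishedAt (IsLocalRing.maximalIdeal ℤ_[p]) ∧
      G.natDegree = X.lambdaInvariant α ∧
      Associated D ((p : Λ) ^ X.muInvariant α * (G : Λ)) := by
  obtain ⟨⟨v₀, -⟩⟩ := (hα 0).1
  obtain ⟨P, hP⟩ := X.exists_degreeZeroMatrix_mul_eq α v₀
  have hdet : PowerSeries.X * P.det = (X.voltageLaplacian α).det := by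
    rw [← hP, Matrix.det_mul, degreeZeroMatrix_det]
  have hP0 : P.det ≠ 0 := fun h0 => X.voltageLaplacian_det_ne_zero α hα (by
    rw [← hdet, h0, mul_zero])
  obtain ⟨l⟩ := X.nonempty_iwasawaJacobian_equiv α v₀ hP
  obtain ⟨G, h1, h2, h3⟩ :=
    (hasIwasawaInvariants_iwasawaInvariants hP0 l).associated_det hP0 l
  exact ⟨P.det, G, hdet, h1, h2, h3⟩

/-- Modulo `ω_m` the entries depend only on the voltages modulo `p^m`, and determinants commute with
reduction. -/
theorem voltageLaplacian_det_sub_mem {α α' : E → ℤ_[p]} {m : ℕ}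
    (h : ∀ e, PadicInt.toZModPow m (α' e) = PadicInt.toZModPow m (α e)) :
    (X.voltageLaplacian α').det - (X.voltageLaplacian α).det ∈
      Ideal.span {((omegaPoly p m : ℤ_[p][X]) : Λ)} := by
  have hpow : ∀ a b : ℤ_[p], PadicInt.toZModPow m a = PadicInt.toZModPow m b →
      Ideal.Quotient.mk (Ideal.span {((omegaPoly p m : ℤ_[p][X]) : Λ)}) (onePlusPow a) =
      Ideal.Quotient.mk _ (onePlusPow b) := fun a b hab =>
    Ideal.Quotient.eq.2 (onePlusPow_sub_mem m hab)
  rw [← Ideal.Quotient.eq, RingHom.map_det, RingHom.map_det]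
  congr 1
  ext w v
  simp only [RingHom.mapMatrix_apply, Matrix.map_apply, voltageLaplacian, Matrix.of_apply,
    firingVector, Pi.add_apply, Finset.sum_apply, Pi.sub_apply, map_add, map_sum, map_sub,
    Pi.single_apply, apply_ite (Ideal.Quotient.mk _), map_zero]
  refine congrArg₂ (· + ·) (Finset.sum_congr rfl fun e _ => ?_) (Finset.sum_congr rfl fun e _ => ?_)
  · rw [hpow _ _ (h e)]
  · rw [hpow (-α' e) (-α e) (by rw [map_neg, map_neg, h e])]

end Multigraph

end IwasawaJacobian

/-! ### Local behaviour of the Iwasawa invariants -/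

theorem theorem6p5 {V E : Type*} [Finite V] [Fintype E] (p : ℕ) [Fact p.Prime]
    (X : Multigraph V E) (hX : X.Connected)
    (α : E → ℤ_[p]) (hα : α ∈ X.voltageCovers p) :
    ∃ m : ℕ,
      (∀ α' ∈ X.coverNhd α m, X.muInvariant α' ≤ X.muInvariant α) ∧
      (∀ α' ∈ X.coverNhd α m, X.muInvariant α' = X.muInvariant α →
        X.lambdaInvariant α' = X.lambdaInvariant α) := by
  classical
  have := Fintype.ofFinite V
  obtain ⟨D, G, hD, hG, hdeg, hass⟩ := X.exists_invariants_of_mem_voltageCovers α hα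
  -- With `m = μ + λ + 1`, `ω_m` lies in the power `μ + λ + 2` of the maximal ideal. The coefficient
  -- of `D' - D` at `n` is that of `T (D' - D)` at `n + 1`, so it is divisible by `p^(μ + λ + 1 -
  -- n)`, which suffices for all `n ≤ λ`.
  have key : ∀ α' ∈ X.coverNhd α (X.muInvariant α + G.natDegree + 1),
      X.muInvariant α' ≤ X.muInvariant α ∧
      (X.muInvariant α' = X.muInvariant α → X.lambdaInvariant α' = X.lambdaInvariant α) := by
    rintro α' ⟨hα', hcong⟩
    obtain ⟨D', G', hD', hG', hdeg', hass'⟩ := X.exists_invariants_of_mem_voltageCovers α' hα'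
    rw [← hdeg, ← hdeg']
    refine invariants_le_of_coeff_sub hG hass hG' hass' fun n hn => ?_
    have hmem : PowerSeries.X * (D' - D) ∈ IsLocalRing.maximalIdeal (PowerSeries ℤ_[p]) ^
        (X.muInvariant α + G.natDegree + 2) := by
      rw [mul_sub, hD, hD']
      obtain ⟨c, hc⟩ := Ideal.mem_span_singleton.1 (X.voltageLaplacian_det_sub_mem hcong)
      rw [hc]
      exact Ideal.mul_mem_right _ _ (coe_omegaPoly_mem _)
    have := pow_dvd_coeff_of_mem_maximalIdeal_pow hmem (n + 1)
    rw [PowerSeries.coeff_succ_X_mul] at this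
    exact (pow_dvd_pow _ (by omega)).trans this
  exact ⟨_, fun α' h => (key α' h).1, fun α' h => (key α' h).2⟩
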